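/- Let $0<\beta\le 1$, $\alpha_3>0$, and let $D_t^\beta f(t)=\frac1{\Gamma(1-\beta)}\int_0^t(t-\tau)^{-\beta}f'(\tau)\,d\tau$ for $\beta<1$, $D_t^1f=f'$, be the Caputo derivative and $E_\beta(z)=\sum_{k\ge0}z^k/\Gamma(k\beta+1)$ the Mittag–Leffler function. Let $\mathcal F:\mathbb R\times\mathbb R^{N\times d}\to\mathbb R^{N\times d}$ be an arbitrary base dynamics for the node features of a graph, with the Frobenius norm on $\mathbb R^{N\times d}$. For a function $V:\mathbb R^{N\times d}\to\mathbb R$ and $p\in\{1,2\}$ consider the projected flow $$D_t^\beta U(t)=\operatorname{Proj}\bigl(\mathcal F(t,U(t)),\ \mathcal K_p(t,U(t))\bigr),\qquad \mathcal K_p=\{D_t^\beta V\le-\alpha_3\|U\|^p\},$$ where $\mathcal K_p(t,x)$ is the set of vectors $G$ such that $D_t^\beta (V\circ W)(t)\le-\alpha_3\|x\|^p$ for every trajectory $W$ that is absolutely continuous on $[0,t]$, is differentiable at $t$ with (if $\beta<1$) absolutely convergent Caputo integral there, and satisfies $W(t)=x$, $D_t^\beta W(t)=G$; $\operatorname{Proj}$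 is a nearest-point projection. A solution on $[0,T]$ is an absolutely continuous $U$ for which, at almost every $t\in(0,T)$, $D_t^\beta U(t)$ exists in the same sense and the equation holds; an equilibrium is a point whose constant trajectory is a solution on every $[0,T]$. A point $U^\star$ is Mittag–Leffler stable if there are $\lambda>0$, $b>0$ and a locally Lipschitz $m\ge0$ with $m(0)=0$ such that $\|U(t)-U^\star\|\le[m(U(0)-U^\star)E_\beta(-\lambda t^\beta)]^b$ for every solution $U$ on an interval $[0,T]$ and every $t\in[0,T]$. (A) Let $\delta>0$, let $\sigma(x)=0$ for $x\le0$, $x^2/(2\delta)$ for $0<x<\delta$, $x-\delta/2$ for $x\ge\delta$, and let $\mathrm{ICNN}$ be a scalar input-convex network with layers $q_1=\sigma(W_0U+b_0)$, $q_{i+1}=\sigma(P_iq_i+W_iU+b_i)$ and entrywise non-negative $P_i$. Then $V(U)=\sigma(\mathrm{ICNN}(U)-\mathrm{ICNN}(0))+\|U\|^2$ is $C^1$, and there are $\alpha_1,\alpha_2>0$ with $\alpha_1\|U\|^2\le V(U)\le\alpha_2\|U\|^2$ for all $U$. (B) Let $V$ be any $C^1$ function with $\alpha_1\|U\|^2\le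 V(U)\le\alpha_2\|U\|^2$ for all $U$, where $\alpha_1,\alpha_2>0$. 1. For $p=1$ and for $p=2$, the origin is Mittag–Leffler stable for the projected flow, and every equilibrium of the flow is the origin; so every equilibrium is Mittag–Leffler stable. 2. For $p=2$, every solution $U$ on $[0,T]$ satisfies, for all $t\in[0,T]$ and with $m=V(U(0))/\alpha_1$, $$V(U(t))\le V(U(0))\,E_\beta\!\left(-\tfrac{\alpha_3}{\alpha_2}t^\beta\right),\qquad \|U(t)\|\le\left[m\,E_\beta\!\left(-\tfrac{\alpha_3}{\alpha_2}t^\beta\right)\right]^{1/2},$$ where $m\ge0$, and $m=0$ if and only if $U(0)=0$. 3. For $p=1$, the two estimates of part 2 hold for every solution with $\alpha_3/\alpha_2$ replaced by $\alpha_3/(\alpha_2\max(1,\sqrt m))$. -/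

import Mathlib

open Set MeasureTheory

/-- Node-feature matrices with `N` nodes and `d` features per node, with the Frobenius norm. -/
abbrev Feature (N d : ℕ) : Type := EuclideanSpace ℝ (Fin N × Fin d)

noncomputable section

/-! ### Caputo derivative and Mittag-Leffler function -/

/-- The Caputo derivative of order `β ∈ (0, 1]` at time `t`, with starting time `0`;
for `β = 1` it is the ordinary derivative. -/
def caputo {E : Type*} [NormedAddCommGroup E] [NormedSpace ℝ E]
    (β : ℝ) (f : ℝ → E) (t : ℝ) : E :=
  if β = 1 then deriv f t
  else (Real.Gamma (1 - β))⁻¹ • ∫ τ in (0 : ℝ)..t, (t - τ) ^ (-β) • deriv f τ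

/-- `caputo β f t` is meaningful: `f` is differentiable at `t` and, if `β ≠ 1`, the integral that
defines the Caputo derivative converges absolutely. -/
def CaputoDifferentiableAt {E : Type*} [NormedAddCommGroup E] [NormedSpace ℝ E]
    (β : ℝ) (f : ℝ → E) (t : ℝ) : Prop :=
  DifferentiableAt ℝ f t ∧
    (β ≠ 1 → IntervalIntegrable (fun τ => (t - τ) ^ (-β) • deriv f τ) volume 0 t)

/-- The one-parameter Mittag-Leffler function `E_β(z) = ∑ z ^ k / Γ(k β + 1)`. -/
def mittagLeffler (β z : ℝ) : ℝ :=
  ∑' k : ℕ, z ^ k / Real.Gamma (k * β + 1)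

/-! ### The projected fractional-order flow -/

/-- `g` is a metric projection of `f` onto `K`. -/
def IsMetricProjection {E : Type*} [NormedAddCommGroup E] (K : Set E) (f g : E) : Prop :=
  g ∈ K ∧ ∀ h ∈ K, ‖f - g‖ ≤ ‖f - h‖

/-- The constraint set `{𝓕 : D_t^β V ≤ -α₃ ‖U‖ ^ p}` at time `t` and state `x`: the vectors `G`
such that, along every trajectory that is at `x` at time `t` and moves there with Caputo velocity
`G`, the Caputo derivative of `V` at time `t` is at most `-α₃ ‖x‖ ^ p`.
(For `t > 0` and a convex `C¹` function `V` this is the half-space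
`⟪∇V(x), G⟫ ≤ -α₃ ‖x‖ ^ p`.) -/
def decreaseSet {N d : ℕ} (β α₃ : ℝ) (p : ℕ) (V : Feature N d → ℝ) (t : ℝ) (x : Feature N d) :
    Set (Feature N d) :=
  {G | ∀ W : ℝ → Feature N d, AbsolutelyContinuousOnInterval W 0 t →
      CaputoDifferentiableAt β W t → W t = x → caputo β W t = G →
      caputo β (fun s => V (W s)) t ≤ -α₃ * ‖x‖ ^ p}

/-- `U` solves on `[0, T]` the projected flow
`D_t^β U = Proj(𝓕(t, U), {𝓕 : D_t^β V ≤ -α₃ ‖U‖ ^ p})`: it is absolutely continuous and satisfies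
the equation at almost every time. The weights of the graph are part of the arbitrary base
dynamics `F`. -/
def IsProjectedSolution {N d : ℕ} (β α₃ : ℝ) (p : ℕ) (F : ℝ → Feature N d → Feature N d)
    (V : Feature N d → ℝ) (T : ℝ) (U : ℝ → Feature N d) : Prop :=
  AbsolutelyContinuousOnInterval U 0 T ∧
    ∀ᵐ t ∂(volume.restrict (Ioo (0 : ℝ) T)), CaputoDifferentiableAt β U t ∧
      IsMetricProjection (decreaseSet β α₃ p V t (U t)) (F t (U t)) (caputo β U t)

/-- `Ustar` is an equilibrium of the projected flow: the constant trajectory is a solution. -/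
def IsProjectedEquilibrium {N d : ℕ} (β α₃ : ℝ) (p : ℕ) (F : ℝ → Feature N d → Feature N d)
    (V : Feature N d → ℝ) (Ustar : Feature N d) : Prop :=
  ∀ T : ℝ, 0 < T → IsProjectedSolution β α₃ p F V T (fun _ => Ustar)

/-- Mittag-Leffler stability of the point `Ustar` for the projected flow. The rate `lam`, the
exponent `b` and the function `m` are the same for all solutions, and the bound holds as long as
the solution exists; the rate is required to be strictly positive. -/
def IsMittagLefflerStable {N d : ℕ} (β α₃ : ℝ) (p : ℕ) (F : ℝ → Feature N d → Feature N d)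
    (V : Feature N d → ℝ) (Ustar : Feature N d) : Prop :=
  ∃ (lam b : ℝ) (m : Feature N d → ℝ), 0 < lam ∧ 0 < b ∧
    m 0 = 0 ∧ (∀ x, 0 ≤ m x) ∧ LocallyLipschitz m ∧
    ∀ (T : ℝ) (U : ℝ → Feature N d), 0 < T → IsProjectedSolution β α₃ p F V T U →
      ∀ t ∈ Icc (0 : ℝ) T,
        ‖U t - Ustar‖ ≤ (m (U 0 - Ustar) * mittagLeffler β (-(lam * t ^ β))) ^ b

/-! ### Lyapunov functions -/

/-- `V` is `C¹` and satisfies `α₁ ‖x‖² ≤ V(x) ≤ α₂ ‖x‖²`. -/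
def IsQuadraticLyapunov {N d : ℕ} (V : Feature N d → ℝ) (α₁ α₂ : ℝ) : Prop :=
  ContDiff ℝ 1 V ∧ ∀ x, α₁ * ‖x‖ ^ 2 ≤ V x ∧ V x ≤ α₂ * ‖x‖ ^ 2

/-- The smooth version of the ReLU function with smoothing parameter `δ`. -/
def smoothReLU (δ x : ℝ) : ℝ :=
  if x ≤ 0 then 0 else if x < δ then x ^ 2 / (2 * δ) else x - δ / 2

/-- The parameters of a scalar-valued input-convex neural network on feature matrices. Layer `i`
has `width i` units; the output layer is layer `depth`, with one unit. The weights `P i` between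
consecutive layers are non-negative, the weights `W i` of the (flattened) input and the biases
are arbitrary. -/
structure ICNN (N d : ℕ) where
  depth : ℕ
  width : ℕ → ℕ
  width_depth : width depth = 1
  W : (i : ℕ) → Matrix (Fin (width i)) (Fin N × Fin d) ℝ
  b : (i : ℕ) → Fin (width i) → ℝ
  P : (i : ℕ) → Matrix (Fin (width (i + 1))) (Fin (width i)) ℝ
  P_nonneg : ∀ i j k, 0 ≤ P i j k

/-- The layers of the network: `σ (W₀ U + b₀)`, and then `σ (P q + W U + b)`, entrywise, where `q`
is the previous layer. -/
def ICNN.layer {N d : ℕ} (net : ICNN N d) (δ : ℝ) (U : Feature N d) :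
    (i : ℕ) → Fin (net.width i) → ℝ
  | 0 => fun j => smoothReLU δ ((net.W 0).mulVec U.ofLp j + net.b 0 j)
  | i + 1 => fun j => smoothReLU δ ((net.P i).mulVec (net.layer δ U i) j +
      (net.W (i + 1)).mulVec U.ofLp j + net.b (i + 1) j)

/-- The scalar output of the network. -/
def ICNN.output {N d : ℕ} (net : ICNN N d) (δ : ℝ) (U : Feature N d) : ℝ :=
  net.layer δ U net.depth (Fin.cast net.width_depth.symm 0)

/-- The Lyapunov function `V(U) = σ(ICNN(U) - ICNN(0)) + ‖U‖²`. -/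
def ICNN.lyapunov {N d : ℕ} (net : ICNN N d) (δ : ℝ) (U : Feature N d) : ℝ :=
  smoothReLU δ (net.output δ U - net.output δ 0) + ‖U‖ ^ 2

end

/-! ### Compositions with continuously differentiable functions -/

/-! The projected velocity lies in the constraint set and the solution is one of the test
trajectories there, so v = V ∘ U satisfies D^β v ≤ -α₃‖U‖^p almost everywhere. The rest is a scalar
comparison argument.

Convexity of φ gives D^β φ(w) ≤ φ'(w) D^β w (`caputo_comp_le`). With φ(x) = max(x,0)², a function w
with w(0) ≤ 0 and D^β w ≤ 0 wherever w > 0 yields y = φ(w) ≥ 0 with y(0) = 0 and D^β y ≤ 0.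
Integrating over time turns D^β y into a positively weighted integral of y, so y = 0
(`nonpos_of_caputo_nonpos`). Since E_β(-λt^β) solves D^β u = -λu, a fractional Grönwall inequality
follows (`le_mul_mittagLeffler`).

For p = 2, V ≤ α₂‖U‖² gives the rate α₃/α₂. For p = 1, v never exceeds v(0), so ‖U‖² ≤ K‖U‖ with K =
max(1, √m), and the rate becomes α₃/(α₂K). Stability requires a rate independent of U(0). If β < 1,
E_β(-x) is comparable with 1/(1+x), so restoring the rate α₃/α₂ costs a factor proportional to K,
absorbed in m. If β = 1, √V falls at least at a constant rate, so the origin is reached in time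
O(‖U(0)‖), and an exponential of that time is absorbed instead.

An equilibrium has zero Caputo derivative of V, which forces its norm to vanish. For the network, σ
is nonnegative, 1-Lipschitz and at most x²/(2δ), whence the quadratic bounds. -/

theorem AbsolutelyContinuousOnInterval.comp_contDiff {E : Type*} [NormedAddCommGroup E]
    [NormedSpace ℝ E] {V : E → ℝ} {U : ℝ → E} {a b : ℝ} (hV : ContDiff ℝ 1 V)
    (hU : AbsolutelyContinuousOnInterval U a b) :
    AbsolutelyContinuousOnInterval (fun s => V (U s)) a b := by
  obtain ⟨K, hK⟩ := (hV.locallyLipschitz.locallyLipschitzOn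
    (s := U '' uIcc a b)).exists_lipschitzOnWith_of_compact
      (isCompact_uIcc.image_of_continuousOn hU.continuousOn)
  unfold AbsolutelyContinuousOnInterval at hU ⊢
  refine squeeze_zero' (Filter.Eventually.of_forall fun _ =>
    Finset.sum_nonneg fun i _ => dist_nonneg) ?_ (by simpa using hU.const_mul (K : ℝ))
  rw [Filter.eventually_inf_principal]
  filter_upwards with E hE
  rw [Finset.mul_sum]
  refine Finset.sum_le_sum fun i hi => ?_
  have h := hE.1 i (Finset.mem_range.1 hi |> fun h => by simpa using h)
  exact hK.dist_le_mul _ (mem_image_of_mem _ h.1) _ (mem_image_of_mem _ h.2)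

/-- `fderiv ℝ V` is bounded on the compact image of `U`, so the new Caputo integrand is dominated by
a multiple of the old one. -/
theorem CaputoDifferentiableAt.comp_contDiff {E : Type*} [NormedAddCommGroup E]
    [NormedSpace ℝ E] {V : E → ℝ} {U : ℝ → E} {β t : ℝ} (ht : 0 ≤ t) (hV : ContDiff ℝ 1 V)
    (hU : AbsolutelyContinuousOnInterval U 0 t)
    (hd : ∀ᵐ s ∂(volume.restrict (Ioo (0 : ℝ) t)), DifferentiableAt ℝ U s)
    (h : CaputoDifferentiableAt β U t) :
    CaputoDifferentiableAt β (fun s => V (U s)) t := by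
  have hV1 : ∀ x, DifferentiableAt ℝ V x := fun x => (hV.differentiable (by simp)) x
  refine ⟨(hV1 _).comp t h.1, fun hβ => ?_⟩
  have hc : IsCompact (U '' uIcc 0 t) := isCompact_uIcc.image_of_continuousOn hU.continuousOn
  obtain ⟨C, hC⟩ := hc.exists_bound_of_continuousOn (hV.continuous_fderiv (by simp)).continuousOn
  have hi := h.2 hβ
  refine IntervalIntegrable.mono_fun (hi.norm.const_mul C) ?_ ?_
  · have hm : Measurable fun τ : ℝ => (t - τ) ^ (-β) := by fun_prop
    exact hm.aestronglyMeasurable.smul (measurable_deriv _).aestronglyMeasurable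
  · rw [uIoc_of_le ht, ← restrict_Ioo_eq_restrict_Ioc]
    filter_upwards [hd, ae_restrict_mem measurableSet_Ioo] with s hs hst
    have hsu : U s ∈ U '' uIcc 0 t :=
      mem_image_of_mem _ (by rw [uIcc_of_le ht]; exact Ioo_subset_Icc_self hst)
    have hds : deriv (fun s => V (U s)) s = fderiv ℝ V (U s) (deriv U s) :=
      ((hV1 (U s)).hasFDerivAt.comp_hasDerivAt s hs.hasDerivAt).deriv
    rw [hds, norm_smul, Real.norm_eq_abs (C * _), norm_smul]
    refine le_trans ?_ (le_abs_self _)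
    calc _ ≤ ‖(t - s) ^ (-β)‖ * (C * ‖deriv U s‖) := by
          gcongr
          exact (ContinuousLinearMap.le_opNorm _ _).trans (by gcongr; exact hC _ hsu)
      _ = _ := by ring

theorem ae_differentiableAt_of_absolutelyContinuousOnInterval {f : ℝ → ℝ} {t : ℝ} (ht : 0 ≤ t)
    (hf : AbsolutelyContinuousOnInterval f 0 t) :
    ∀ᵐ s ∂(volume.restrict (Ioo (0 : ℝ) t)), DifferentiableAt ℝ f s := by
  rw [ae_restrict_iff' measurableSet_Ioo]
  filter_upwards [hf.ae_differentiableAt] with s hs hst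
  exact hs (by rw [uIcc_of_le ht]; exact Ioo_subset_Icc_self hst)

/-! ### The Caputo derivative and convex functions -/

theorem hasDerivAt_kernel {t τ : ℝ} (β : ℝ) (h : τ < t) :
    HasDerivAt (fun s => (t - s) ^ (-β)) (β * (t - τ) ^ (-β - 1)) τ := by
  have h1 : HasDerivAt (fun s : ℝ => t - s) (-1) τ := by
    simpa using (hasDerivAt_id τ).const_sub t
  have := h1.rpow_const (p := -β) (Or.inl (sub_pos.2 h).ne')
  convert this using 1
  ring

theorem absolutelyContinuousOnInterval_kernel {t s : ℝ} (β : ℝ) (hs : 0 ≤ s) (hst : s < t) :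
    AbsolutelyContinuousOnInterval (fun τ => (t - τ) ^ (-β)) 0 s := by
  refine ContDiffOn.absolutelyContinuousOnInterval fun τ hτ => ContDiffAt.contDiffWithinAt ?_
  rw [uIcc_of_le hs] at hτ
  exact ContDiffAt.rpow_const_of_ne (by fun_prop) (by linarith [hτ.2])

open Filter Topology in
/-- The Caputo derivative of a nonnegative function at a zero is nonpositive. -/
theorem integral_kernel_mul_deriv_nonpos {h : ℝ → ℝ} {β t : ℝ} (hβ₀ : 0 < β) (hβ₁ : β < 1)
    (ht : 0 < t) (hac : AbsolutelyContinuousOnInterval h 0 t)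
    (hint : IntervalIntegrable (fun τ => (t - τ) ^ (-β) * deriv h τ) volume 0 t)
    (hpos : ∀ s ∈ Icc 0 t, 0 ≤ h s) (h0 : h t = 0) (hd : DifferentiableAt ℝ h t) :
    ∫ τ in (0 : ℝ)..t, (t - τ) ^ (-β) * deriv h τ ≤ 0 := by
  -- The kernel is singular at `t`, so integration by parts stops at `s < t`. The kernel increases
  -- in `τ`, hence every term except the boundary term at `s` has a favourable sign.
  have key : ∀ s ∈ Ioo 0 t,
      ∫ τ in (0 : ℝ)..s, (t - τ) ^ (-β) * deriv h τ ≤ (t - s) ^ (-β) * h s := by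
    intro s hs
    have hac' : AbsolutelyContinuousOnInterval h 0 s := hac.mono (by
      rw [uIcc_of_le hs.1.le, uIcc_of_le ht.le]; exact Icc_subset_Icc_right hs.2.le)
    rw [(absolutelyContinuousOnInterval_kernel β hs.1.le hs.2).integral_mul_deriv_eq_deriv_mul hac']
    have h1 : 0 ≤ ∫ τ in (0 : ℝ)..s, deriv (fun τ => (t - τ) ^ (-β)) τ * h τ := by
      refine intervalIntegral.integral_nonneg hs.1.le fun τ hτ => ?_
      have hτt : τ < t := hτ.2.trans_lt hs.2
      rw [(hasDerivAt_kernel β hτt).deriv]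
      have : 0 < t - τ := sub_pos.2 hτt
      have := hpos τ ⟨hτ.1, hτt.le⟩
      positivity
    have h2 : 0 ≤ (t - 0) ^ (-β) * h 0 := by
      have := hpos 0 ⟨le_rfl, ht.le⟩
      have : 0 ≤ t - 0 := by linarith
      positivity
    linarith
  have hcont : Tendsto (fun s => ∫ τ in (0 : ℝ)..s, (t - τ) ^ (-β) * deriv h τ) (𝓝[<] t)
      (𝓝 (∫ τ in (0 : ℝ)..t, (t - τ) ^ (-β) * deriv h τ)) := by
    have := intervalIntegral.continuousOn_primitive_interval (μ := volume) (a := 0) (b := t)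
      (f := fun τ => (t - τ) ^ (-β) * deriv h τ) (by
        rwa [uIcc_of_le ht.le, integrableOn_Icc_iff_integrableOn_Ioc,
          ← intervalIntegrable_iff_integrableOn_Ioc_of_le ht.le])
    rw [uIcc_of_le ht.le] at this
    refine (this t ⟨ht.le, le_rfl⟩).mono_left ?_
    rw [← nhdsWithin_Ioo_eq_nhdsLT ht]
    exact nhdsWithin_mono _ Ioo_subset_Icc_self
  -- Since `h t = 0` and `h` is differentiable at `t`, `h s` is O(t - s), and the boundary term is
  -- O((t - s)^(1 - β)).
  have hlim : Tendsto (fun s => (t - s) ^ (-β) * h s) (𝓝[<] t) (𝓝 0) := by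
    have hs : Tendsto (slope h t) (𝓝[<] t) (𝓝 (deriv h t)) :=
      (hasDerivAt_iff_tendsto_slope.1 hd.hasDerivAt).mono_left
        (nhdsWithin_mono _ fun x hx => ne_of_lt hx)
    have hp : Tendsto (fun s : ℝ => (t - s) ^ (1 - β)) (𝓝[<] t) (𝓝 0) := by
      have : ContinuousAt (fun s : ℝ => (t - s) ^ (1 - β)) t :=
        ContinuousAt.rpow_const (by fun_prop) (Or.inr (by linarith))
      have h2 := this.tendsto
      simp only [sub_self, Real.zero_rpow (by linarith : (1 - β) ≠ 0)] at h2
      exact h2.mono_left nhdsWithin_le_nhds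
    have := (hp.mul hs).neg
    simp only [zero_mul, neg_zero] at this
    refine this.congr' ?_
    filter_upwards [self_mem_nhdsWithin] with s hs
    have hs' : 0 < t - s := sub_pos.2 hs
    rw [slope_def_field, h0, sub_eq_add_neg 1 β, Real.rpow_add hs', Real.rpow_one]
    have : s - t ≠ 0 := by linarith
    field_simp
    ring
  refine le_of_tendsto_of_tendsto hcont hlim ?_
  rw [← nhdsWithin_Ioo_eq_nhdsLT ht]
  filter_upwards [self_mem_nhdsWithin] with s hs using key s hs

/-- Alikhanov's inequality: the Caputo derivative of a convex function of `w` is at most the value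
given by the chain rule. -/
theorem caputo_comp_le {φ w : ℝ → ℝ} {β t : ℝ} (hβ₀ : 0 < β) (hβ₁ : β ≤ 1) (ht : 0 < t)
    (hφ : ContDiff ℝ 1 φ) (htan : ∀ x y, φ x + deriv φ x * (y - x) ≤ φ y)
    (hw : AbsolutelyContinuousOnInterval w 0 t) (hc : CaputoDifferentiableAt β w t) :
    caputo β (fun s => φ (w s)) t ≤ deriv φ (w t) * caputo β w t := by
  have hφd : ∀ x, DifferentiableAt ℝ φ x := fun x => (hφ.differentiable (by simp)) x
  have hchain : ∀ s, DifferentiableAt ℝ w s →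
      HasDerivAt (fun s => φ (w s)) (deriv φ (w s) * deriv w s) s :=
    fun s hs => (hφd (w s)).hasDerivAt.comp s hs.hasDerivAt
  rcases hβ₁.eq_or_lt with rfl | hβ₁
  · simp [caputo, (hchain t hc.1).deriv]
  have hwd := ae_differentiableAt_of_absolutelyContinuousOnInterval ht.le hw
  have hc' := CaputoDifferentiableAt.comp_contDiff ht.le hφ hw hwd hc
  have i1 := hc.2 hβ₁.ne
  have i2 := hc'.2 hβ₁.ne
  simp only [caputo, hβ₁.ne, if_false, smul_eq_mul] at i1 i2 ⊢
  obtain ⟨c, hcφ⟩ : ∃ c, c = deriv φ (w t) := ⟨_, rfl⟩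
  -- The gap between φ ∘ w and the tangent of φ at `w t`: nonnegative by convexity (`htan`), zero at
  -- time `t`.
  obtain ⟨h, hh⟩ : ∃ h : ℝ → ℝ, h = fun s => φ (w s) - (φ (w t) + c * (w s - w t)) := ⟨_, rfl⟩
  rw [← hcφ]
  have hder : ∀ s, DifferentiableAt ℝ w s →
      HasDerivAt h (deriv (fun s => φ (w s)) s - c * deriv w s) s := by
    intro s hs
    have := (hchain s hs)
    rw [this.deriv, hh]
    exact this.sub (((hs.hasDerivAt.sub_const (w t)).const_mul _).const_add _)
  have hae : ∀ᵐ s ∂(volume.restrict (uIoc (0 : ℝ) t)), (t - s) ^ (-β) * deriv h s =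
      (t - s) ^ (-β) * deriv (fun s => φ (w s)) s -
        c * ((t - s) ^ (-β) * deriv w s) := by
    rw [uIoc_of_le ht.le, ← restrict_Ioo_eq_restrict_Ioc]
    filter_upwards [hwd] with s hs
    rw [(hder s hs).deriv]; ring
  have hpsi : ContDiff ℝ 1 fun x => φ x - (φ (w t) + c * (x - w t)) := by fun_prop
  have hac : AbsolutelyContinuousOnInterval h 0 t := by
    rw [hh]
    exact AbsolutelyContinuousOnInterval.comp_contDiff
      (V := fun x => φ x - (φ (w t) + c * (x - w t))) hpsi hw
  have hle := integral_kernel_mul_deriv_nonpos (h := h) hβ₀ hβ₁ ht hac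
    ((i2.sub (i1.const_mul _)).congr_ae (by
      filter_upwards [hae] with s hs using hs.symm))
    (fun s _ => by have := htan (w t) (w s); rw [← hcφ] at this; simp only [hh]; linarith)
    (by simp [hh]) (hder t hc.1).differentiableAt
  rw [intervalIntegral.integral_congr_ae_restrict hae,
    intervalIntegral.integral_sub i2 (i1.const_mul _),
    intervalIntegral.integral_const_mul] at hle
  have hG : 0 < (Real.Gamma (1 - β))⁻¹ := inv_pos.2 (Real.Gamma_pos_of_pos (by linarith))
  rw [mul_left_comm]
  exact mul_le_mul_of_nonneg_left (by linarith) hG.le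

/-! ### The time integral of the Caputo derivative -/

theorem intervalIntegrable_kernel {β : ℝ} (hβ₁ : β < 1) (T : ℝ) :
    IntervalIntegrable (fun s : ℝ => (T - s) ^ (-β)) volume 0 T := by
  have := (intervalIntegral.intervalIntegrable_rpow' (a := T) (b := 0)
    (by linarith : -1 < -β)).comp_sub_left T
  simpa using this

/-- Fubini on the triangle τ < t. Truncating the kernel to `Ioc 0 T` makes the integrand that of a
convolution of two integrable functions, which supplies joint integrability. -/
theorem integral_integral_kernel_mul {f : ℝ → ℝ} {β T : ℝ} (hβ₁ : β < 1) (hT : 0 < T)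
    (hf : IntervalIntegrable f volume 0 T) :
    ∫ t in (0 : ℝ)..T, ∫ τ in (0 : ℝ)..t, (t - τ) ^ (-β) * f τ =
      ∫ τ in (0 : ℝ)..T, (∫ s in τ..T, (T - s) ^ (-β)) * f τ := by
  rw [intervalIntegrable_iff_integrableOn_Ioc_of_le hT.le] at hf
  have hk : IntegrableOn (fun s : ℝ => s ^ (-β)) (Ioc 0 T) := by
    rw [← intervalIntegrable_iff_integrableOn_Ioc_of_le hT.le]
    exact intervalIntegral.intervalIntegrable_rpow' (by linarith)
  have hk' := (integrable_indicator_iff measurableSet_Ioc).2 hk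
  have hint := Integrable.convolution_integrand (μ := volume) (ContinuousLinearMap.mul ℝ ℝ) hf hk'
  have hint' := hint.mono_measure (μ := (volume.restrict (Ioc 0 T)).prod
    (volume.restrict (Ioc 0 T))) (Measure.prod_mono Measure.restrict_le_self le_rfl)
  have hswap := integral_integral_swap
    (f := fun t τ => f τ * (Ioc 0 T).indicator (fun s : ℝ => s ^ (-β)) (t - τ)) hint'
  rw [intervalIntegral.integral_of_le hT.le, intervalIntegral.integral_of_le hT.le]
  convert hswap using 1
  · refine setIntegral_congr_fun measurableSet_Ioc fun t ht => ?_
    rw [intervalIntegral.integral_of_le ht.1.le, ← integral_indicator measurableSet_Ioc,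
      ← integral_indicator measurableSet_Ioc]
    refine integral_congr_ae ?_
    -- The point τ = t is discarded because the indicator kills the kernel at 0, where the
    -- untruncated kernel has a default value.
    filter_upwards [compl_mem_ae_iff.2 (measure_singleton (μ := volume) t)] with τ hτ
    have hτt : τ ≠ t := hτ
    simp only [indicator, mem_Ioc]
    have := ht.1
    have := ht.2
    by_cases h1 : 0 < τ ∧ τ ≤ t
    · have h3 : τ < t := lt_of_le_of_ne h1.2 hτt
      rw [if_pos h1, if_pos ⟨h1.1, by linarith⟩, if_pos ⟨by linarith, by linarith⟩, mul_comm]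
    · rw [if_neg h1]
      by_cases h2 : 0 < τ ∧ τ ≤ T
      · rw [if_pos h2, if_neg, mul_zero]
        rintro ⟨h4, -⟩
        exact h1 ⟨h2.1, by linarith⟩
      · rw [if_neg h2]
  · refine setIntegral_congr_fun measurableSet_Ioc fun τ hτ => ?_
    rw [integral_const_mul, mul_comm]
    congr 1
    have e1 : ∫ s in τ..T, (T - s) ^ (-β) = ∫ s in τ..T, (s - τ) ^ (-β) := by
      rw [intervalIntegral.integral_comp_sub_left (fun s : ℝ => s ^ (-β)),
        intervalIntegral.integral_comp_sub_right (fun s : ℝ => s ^ (-β))]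
      simp
    rw [e1, intervalIntegral.integral_of_le hτ.2, ← integral_indicator measurableSet_Ioc,
      ← integral_indicator measurableSet_Ioc]
    refine integral_congr_ae (Filter.Eventually.of_forall fun t => ?_)
    simp only [indicator, mem_Ioc]
    have := hτ.1
    have := hτ.2
    by_cases h1 : τ < t ∧ t ≤ T
    · rw [if_pos h1, if_pos ⟨by linarith, h1.2⟩, if_pos ⟨by linarith, by linarith⟩]
    · rw [if_neg h1]
      by_cases h2 : 0 < t ∧ t ≤ T
      · rw [if_pos h2, if_neg]
        rintro ⟨h4, -⟩
        exact h1 ⟨by linarith, h2.2⟩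
      · rw [if_neg h2]

/-- Up to Γ(1-β), the time integral of D^β w is the fractional integral of order 1-β of w - w(0).
After the exchange of integrals, the derivative is moved from `w` to the primitive `G` of the
kernel. -/
theorem integral_integral_kernel_mul_deriv {w : ℝ → ℝ} {β T : ℝ} (hβ₁ : β < 1) (hT : 0 < T)
    (hw : AbsolutelyContinuousOnInterval w 0 T) :
    ∫ t in (0 : ℝ)..T, ∫ τ in (0 : ℝ)..t, (t - τ) ^ (-β) * deriv w τ =
      ∫ τ in (0 : ℝ)..T, (w τ - w 0) * (T - τ) ^ (-β) := by
  have hk := intervalIntegrable_kernel hβ₁ T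
  have hsub : ∀ τ ∈ uIcc 0 T, IntervalIntegrable (fun s : ℝ => (T - s) ^ (-β)) volume 0 τ :=
    fun τ hτ => hk.mono_set (uIcc_subset_uIcc left_mem_uIcc hτ)
  rw [integral_integral_kernel_mul hβ₁ hT hw.intervalIntegrable_deriv]
  set G : ℝ → ℝ := fun τ => ∫ s in (0 : ℝ)..τ, (T - s) ^ (-β) with hG
  have hGac : AbsolutelyContinuousOnInterval G 0 T :=
    hk.absolutelyContinuousOnInterval_intervalIntegral left_mem_uIcc
  have hconst : AbsolutelyContinuousOnInterval (fun _ : ℝ => w 0) 0 T :=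
    ContDiffOn.absolutelyContinuousOnInterval contDiffOn_const
  have hparts := (hw.fun_sub hconst).integral_mul_deriv_eq_deriv_mul hGac
  have e1 : ∫ τ in (0 : ℝ)..T, (w τ - w 0) * (T - τ) ^ (-β) =
      ∫ τ in (0 : ℝ)..T, (w τ - w 0) * deriv G τ := by
    refine intervalIntegral.integral_congr_ae ?_
    filter_upwards [hk.ae_hasDerivAt_integral] with τ hτ hτm
    rw [(hτ (uIoc_subset_uIcc hτm) 0 left_mem_uIcc).deriv]
  have e2 : ∫ τ in (0 : ℝ)..T, (∫ s in τ..T, (T - s) ^ (-β)) * deriv w τ =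
      ∫ τ in (0 : ℝ)..T, (G T * deriv w τ - deriv (fun x => w x - w 0) τ * G τ) := by
    refine intervalIntegral.integral_congr fun τ hτ => ?_
    simp only [deriv_sub_const]
    rw [← intervalIntegral.integral_interval_sub_left (hsub T right_mem_uIcc) (hsub τ hτ)]
    simp only [hG]
    ring
  rw [e1, hparts, e2, intervalIntegral.integral_sub
      (hw.intervalIntegrable_deriv.const_mul _)
      ((hw.fun_sub hconst).intervalIntegrable_deriv.mul_continuousOn hGac.continuousOn),
    intervalIntegral.integral_const_mul, hw.integral_deriv_eq_sub]
  simp [hG]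
  ring

/-! ### The comparison principle -/

/-- For β < 1, the integral of y against the positive weight (T - τ)^(-β) is both nonpositive and
nonnegative, so y vanishes almost everywhere, and everywhere by continuity. -/
theorem eqOn_zero_of_caputo_nonpos {y : ℝ → ℝ} {β T : ℝ} (hβ₁ : β ≤ 1) (hT : 0 < T)
    (hy : AbsolutelyContinuousOnInterval y 0 T) (hy0 : y 0 = 0) (hpos : ∀ t ∈ Icc 0 T, 0 ≤ y t)
    (hc : ∀ᵐ t ∂(volume.restrict (Ioo (0 : ℝ) T)), caputo β y t ≤ 0) :
    ∀ t ∈ Icc 0 T, y t = 0 := by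
  rcases hβ₁.eq_or_lt with rfl | hβ₁
  · intro t ht
    have hac : AbsolutelyContinuousOnInterval y 0 t := hy.mono (by
      rw [uIcc_of_le ht.1, uIcc_of_le hT.le]; exact Icc_subset_Icc_right ht.2)
    have h1 := hac.integral_deriv_eq_sub
    have h2 : ∫ s in (0 : ℝ)..t, deriv y s ≤ 0 := by
      rw [intervalIntegral.integral_of_le ht.1, integral_Ioc_eq_integral_Ioo]
      refine integral_nonpos_of_ae ?_
      filter_upwards [ae_mono (Measure.restrict_mono (Ioo_subset_Ioo_right ht.2) le_rfl) hc]
        with s hs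
      simpa [caputo] using hs
    have := hpos t ht
    linarith
  · have hI := integral_integral_kernel_mul_deriv hβ₁ hT hy
    have hle : ∫ t in (0 : ℝ)..T, ∫ τ in (0 : ℝ)..t, (t - τ) ^ (-β) * deriv y τ ≤ 0 := by
      rw [intervalIntegral.integral_of_le hT.le, integral_Ioc_eq_integral_Ioo]
      refine integral_nonpos_of_ae ?_
      filter_upwards [hc] with t ht
      simp only [caputo, hβ₁.ne, if_false, smul_eq_mul] at ht
      have hG : 0 < (Real.Gamma (1 - β))⁻¹ := inv_pos.2 (Real.Gamma_pos_of_pos (by linarith))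
      exact nonpos_of_mul_nonpos_right ht hG
    have hnn : 0 ≤ᵐ[volume.restrict (Ioc 0 T)] fun τ => (y τ - y 0) * (T - τ) ^ (-β) := by
      filter_upwards [ae_restrict_mem measurableSet_Ioc] with τ hτ
      have h1 := hpos τ ⟨hτ.1.le, hτ.2⟩
      have h2 : 0 ≤ T - τ := sub_nonneg.2 hτ.2
      rw [hy0, sub_zero]
      exact mul_nonneg h1 (Real.rpow_nonneg h2 _)
    have hint : IntervalIntegrable (fun τ => (y τ - y 0) * (T - τ) ^ (-β)) volume 0 T :=
      (intervalIntegrable_kernel hβ₁ T).continuousOn_mul (hy.continuousOn.sub continuousOn_const)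
    have hz : ∫ τ in (0 : ℝ)..T, (y τ - y 0) * (T - τ) ^ (-β) = 0 :=
      le_antisymm (hI ▸ hle) (intervalIntegral.integral_nonneg_of_ae_restrict hT.le (by
        rwa [restrict_Ioc_eq_restrict_Icc] at hnn))
    rw [intervalIntegral.integral_eq_zero_iff_of_le_of_nonneg_ae hT.le hnn hint] at hz
    have hae : y =ᵐ[volume.restrict (Icc 0 T)] fun _ => 0 := by
      rw [← restrict_Ioo_eq_restrict_Icc]
      rw [← restrict_Ioo_eq_restrict_Ioc] at hz
      filter_upwards [hz, ae_restrict_mem measurableSet_Ioo] with τ h1 h2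
      have h3 : 0 < T - τ := sub_pos.2 h2.2
      have h4 := Real.rpow_pos_of_pos h3 (-β)
      simp only [hy0, sub_zero, Pi.zero_apply] at h1
      exact (mul_eq_zero.1 h1).resolve_right h4.ne'
    have hcont := hy.continuousOn
    rw [uIcc_of_le hT.le] at hcont
    exact Measure.eqOn_Icc_of_ae_eq volume hT.ne hae hcont continuousOn_const

theorem hasDerivAt_sq_max_zero (x : ℝ) :
    HasDerivAt (fun x : ℝ => max x 0 ^ 2) (2 * max x 0) x := by
  rcases lt_trichotomy x 0 with h | rfl | h
  · rw [max_eq_right h.le, mul_zero]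
    refine (hasDerivAt_const x (0 : ℝ)).congr_of_eventuallyEq ?_
    filter_upwards [eventually_lt_nhds h] with y hy
    simp [max_eq_right hy.le]
  · have hO : (fun y : ℝ => max y 0 ^ 2) =O[nhds 0] fun y => ‖y - 0‖ ^ 2 := by
      refine Asymptotics.IsBigO.of_bound 1 (Filter.Eventually.of_forall fun y => ?_)
      rcases le_total y 0 with hy | hy
      · simp [max_eq_right hy]
        positivity
      · simp [max_eq_left hy]
    have h := (hO.hasFDerivAt (𝕜 := ℝ) one_lt_two).hasDerivAt
    simpa using h
  · rw [max_eq_left h.le]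
    have h2 : HasDerivAt (fun y : ℝ => y ^ 2) (2 * x) x := by simpa using hasDerivAt_pow 2 x
    refine h2.congr_of_eventuallyEq ?_
    filter_upwards [eventually_gt_nhds h] with y hy
    simp [max_eq_left hy.le]

theorem contDiff_sq_max_zero : ContDiff ℝ 1 fun x : ℝ => max x 0 ^ 2 := by
  rw [contDiff_one_iff_deriv]
  refine ⟨fun x => (hasDerivAt_sq_max_zero x).differentiableAt, ?_⟩
  rw [show deriv (fun x : ℝ => max x 0 ^ 2) = fun x => 2 * max x 0 from
    funext fun x => (hasDerivAt_sq_max_zero x).deriv]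
  fun_prop

/-- Comparison principle: an absolutely continuous function that starts nonpositive and whose Caputo
derivative is nonpositive wherever the function is positive, stays nonpositive. -/
theorem nonpos_of_caputo_nonpos {w : ℝ → ℝ} {β T : ℝ} (hβ₀ : 0 < β) (hβ₁ : β ≤ 1) (hT : 0 < T)
    (hw : AbsolutelyContinuousOnInterval w 0 T) (hw0 : w 0 ≤ 0)
    (hc : ∀ᵐ t ∂(volume.restrict (Ioo (0 : ℝ) T)),
      CaputoDifferentiableAt β w t ∧ (0 < w t → caputo β w t ≤ 0)) :
    ∀ t ∈ Icc 0 T, w t ≤ 0 := by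
  -- The square makes the positive part C¹ while keeping it convex; its derivative 2 max(w,0)
  -- vanishes exactly where the sign of D^β w is unknown.
  have hz := eqOn_zero_of_caputo_nonpos (y := fun s => max (w s) 0 ^ 2) hβ₁ hT
    (AbsolutelyContinuousOnInterval.comp_contDiff (V := fun x => max x 0 ^ 2)
      contDiff_sq_max_zero hw) (by simp [hw0]) (fun _ _ => sq_nonneg _) (by
      filter_upwards [hc, ae_restrict_mem measurableSet_Ioo] with t ht htm
      have hac : AbsolutelyContinuousOnInterval w 0 t := hw.mono (by
        rw [uIcc_of_le htm.1.le, uIcc_of_le hT.le]; exact Icc_subset_Icc_right htm.2.le)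
      refine (caputo_comp_le (φ := fun x => max x 0 ^ 2) hβ₀ hβ₁ htm.1 contDiff_sq_max_zero ?_
        hac ht.1).trans ?_
      · intro x y
        rw [(hasDerivAt_sq_max_zero x).deriv]
        rcases le_total x 0 with hx | hx
        · simp [max_eq_right hx]
        · rw [max_eq_left hx]
          nlinarith [le_max_left y 0, sq_nonneg (x - max y 0)]
      · rw [(hasDerivAt_sq_max_zero (w t)).deriv]
        rcases le_or_gt (w t) 0 with h | h
        · simp [max_eq_right h]
        · exact mul_nonpos_of_nonneg_of_nonpos (by positivity) (ht.2 h))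
  intro t ht
  have h1 := hz t ht
  simp only [ne_eq, OfNat.ofNat_ne_zero, not_false_eq_true, pow_eq_zero_iff] at h1
  exact h1 ▸ le_max_left _ _

/-! ### Mittag-Leffler functions -/

/-- Only the part s > M of the Gamma integral is kept. As M is free, Γ(kβ+1) outgrows every
geometric sequence. -/
theorem rpow_mul_exp_neg_le_Gamma {M x : ℝ} (hM : 0 < M) (hx : 0 ≤ x) :
    M ^ x * Real.exp (-M) ≤ Real.Gamma (x + 1) := by
  have hint := Real.GammaIntegral_convergent (s := x + 1) (by linarith)
  rw [Real.Gamma_eq_integral (by linarith)]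
  calc M ^ x * Real.exp (-M) = ∫ s in Ioi M, Real.exp (-s) * M ^ x := by
        rw [integral_mul_const, integral_exp_neg_Ioi, mul_comm]
    _ ≤ ∫ s in Ioi M, Real.exp (-s) * s ^ (x + 1 - 1) := by
        refine setIntegral_mono_on ((integrableOn_exp_neg_Ioi M).mul_const _)
          (hint.mono_set (Ioi_subset_Ioi hM.le)) measurableSet_Ioi fun s hs => ?_
        rw [add_sub_cancel_right]
        have : M ≤ s := le_of_lt hs
        gcongr
    _ ≤ _ := by
        refine setIntegral_mono_set hint ?_ (Ioi_subset_Ioi hM.le).eventuallyLE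
        filter_upwards [ae_restrict_mem measurableSet_Ioi] with s hs
        have : (0 : ℝ) < s := hs
        positivity

theorem Gamma_mul_add_one_pos {β : ℝ} (hβ : 0 < β) (k : ℕ) : 0 < Real.Gamma (k * β + 1) :=
  Real.Gamma_pos_of_pos (by positivity)

theorem summable_mittagLeffler {β : ℝ} (hβ : 0 < β) (z : ℝ) :
    Summable fun k : ℕ => z ^ k / Real.Gamma (k * β + 1) := by
  set R : ℝ := |z| + 1 with hR
  have hRpos : 0 < R := by positivity
  -- Chosen so that M^(kβ) = (2R)^k, leaving a geometric series of ratio 1/2.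
  set M : ℝ := (2 * R) ^ β⁻¹ with hM
  have hMpos : 0 < M := by positivity
  refine Summable.of_norm_bounded
    ((summable_geometric_of_lt_one (r := 1 / 2) (by norm_num) (by norm_num)).mul_left
      (Real.exp M)) fun k => ?_
  have hG := Gamma_mul_add_one_pos hβ k
  rw [norm_div, norm_pow, Real.norm_eq_abs, Real.norm_of_nonneg hG.le, div_le_iff₀ hG]
  have h1 := rpow_mul_exp_neg_le_Gamma hMpos (by positivity : (0 : ℝ) ≤ k * β)
  have h2 : M ^ ((k : ℝ) * β) = (2 * R) ^ k := by
    rw [hM, ← Real.rpow_mul (by positivity), ← Real.rpow_natCast]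
    congr 1
    field_simp
  rw [h2] at h1
  calc |z| ^ k ≤ R ^ k := by gcongr; linarith
    _ = Real.exp M * (1 / 2) ^ k * ((2 * R) ^ k * Real.exp (-M)) := by
        rw [Real.exp_neg, mul_pow, one_div, inv_pow]
        field_simp
    _ ≤ _ := by gcongr

theorem summable_deriv_mittagLeffler {β : ℝ} (hβ : 0 < β) {R : ℝ} (hR : 1 ≤ R) :
    Summable fun k : ℕ => k * R ^ (k - 1) / Real.Gamma (k * β + 1) := by
  refine Summable.of_nonneg_of_le (fun k => ?_) (fun k => ?_) (summable_mittagLeffler hβ (2 * R))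
  · have := Gamma_mul_add_one_pos hβ k
    positivity
  · have := Gamma_mul_add_one_pos hβ k
    gcongr
    rw [mul_pow]
    have h1 : (k : ℝ) ≤ 2 ^ k := by exact_mod_cast Nat.lt_two_pow_self.le
    have h2 : R ^ (k - 1) ≤ R ^ k := pow_le_pow_right₀ hR (Nat.sub_le _ _)
    gcongr

theorem norm_deriv_mittagLeffler_term_le {β : ℝ} (hβ : 0 < β) {R z : ℝ}
    (hz : z ∈ Ioo (-R) R) (k : ℕ) :
    ‖k * z ^ (k - 1) / Real.Gamma (k * β + 1)‖ ≤ k * R ^ (k - 1) / Real.Gamma (k * β + 1) := by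
  have hG := Gamma_mul_add_one_pos hβ k
  rw [norm_div, norm_mul, norm_pow, Real.norm_of_nonneg hG.le, Real.norm_natCast,
    Real.norm_eq_abs]
  have := (abs_lt.2 hz).le
  gcongr

theorem hasDerivAt_mittagLeffler {β : ℝ} (hβ : 0 < β) (z : ℝ) :
    HasDerivAt (mittagLeffler β) (∑' k : ℕ, k * z ^ (k - 1) / Real.Gamma (k * β + 1)) z := by
  have hz : z ∈ Ioo (-(|z| + 1)) (|z| + 1) := abs_lt.1 (by linarith)
  exact hasDerivAt_tsum_of_isPreconnected (summable_deriv_mittagLeffler hβ (R := |z| + 1)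
    (by linarith [abs_nonneg z])) isOpen_Ioo isPreconnected_Ioo
    (fun k y _ => (hasDerivAt_pow k y).div_const _)
    (fun k y hy => norm_deriv_mittagLeffler_term_le hβ hy k) hz (summable_mittagLeffler hβ z) hz

/-- For β < 1, t ↦ E_β(-λt^β) is in general not C¹ at 0; its absolute continuity and Caputo
differentiability are inherited from t^β through this outer function. -/
theorem contDiff_mittagLeffler {β : ℝ} (hβ : 0 < β) : ContDiff ℝ 1 (mittagLeffler β) := by
  rw [contDiff_one_iff_deriv]
  refine ⟨fun z => (hasDerivAt_mittagLeffler hβ z).differentiableAt, ?_⟩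
  rw [show deriv (mittagLeffler β) = _ from
    funext fun z => (hasDerivAt_mittagLeffler hβ z).deriv]
  refine continuous_iff_continuousAt.2 fun z => ?_
  have hz : Ioo (-(|z| + 1)) (|z| + 1) ∈ nhds z :=
    isOpen_Ioo.mem_nhds (abs_lt.1 (by linarith))
  exact (continuousOn_tsum (fun k => (by fun_prop))
    (summable_deriv_mittagLeffler hβ (R := |z| + 1) (by linarith [abs_nonneg z]))
    fun k y hy => norm_deriv_mittagLeffler_term_le hβ hy k).continuousAt hz

theorem mittagLeffler_zero (β : ℝ) : mittagLeffler β 0 = 1 := by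
  unfold mittagLeffler
  rw [tsum_eq_single 0 fun k hk => by simp [hk]]
  simp

theorem mittagLeffler_one (z : ℝ) : mittagLeffler 1 z = Real.exp z := by
  rw [mittagLeffler, Real.exp_eq_exp_ℝ, NormedSpace.exp_eq_tsum_div]
  refine tsum_congr fun k => ?_
  rw [mul_one, Real.Gamma_nat_eq_factorial]

theorem integral_rpow_mul_rpow {p q t : ℝ} (hp : 0 < p) (hq : 0 < q) (ht : 0 < t) :
    ∫ τ in (0 : ℝ)..t, τ ^ (p - 1) * (t - τ) ^ (q - 1) =
      t ^ (p + q - 1) * (Real.Gamma p * Real.Gamma q / Real.Gamma (p + q)) := by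
  have h := Complex.betaIntegral_scaled p q ht
  rw [Complex.betaIntegral_eq_Gamma_mul_div p q (by simpa) (by simpa)] at h
  have e : ∀ τ ∈ uIcc 0 t, (τ : ℂ) ^ ((p : ℂ) - 1) * ((t : ℂ) - τ) ^ ((q : ℂ) - 1) =
      ((τ ^ (p - 1) * (t - τ) ^ (q - 1) : ℝ) : ℂ) := by
    intro τ hτ
    rw [uIcc_of_le ht.le] at hτ
    rw [Complex.ofReal_mul, Complex.ofReal_cpow hτ.1, Complex.ofReal_cpow (sub_nonneg.2 hτ.2)]
    push_cast
    rfl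
  rw [intervalIntegral.integral_congr e, intervalIntegral.integral_ofReal] at h
  have e2 : (t : ℂ) ^ ((p : ℂ) + q - 1) = ((t ^ (p + q - 1) : ℝ) : ℂ) := by
    rw [Complex.ofReal_cpow ht.le]; push_cast; rfl
  rw [e2, ← Complex.ofReal_add, Complex.Gamma_ofReal, Complex.Gamma_ofReal,
    Complex.Gamma_ofReal] at h
  exact_mod_cast h

/-- A non-integrable function has integral 0 by convention, whereas the beta integral is positive.
-/
theorem intervalIntegrable_rpow_mul_rpow {p q t : ℝ} (hp : 0 < p) (hq : 0 < q) (ht : 0 < t) :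
    IntervalIntegrable (fun τ : ℝ => τ ^ (p - 1) * (t - τ) ^ (q - 1)) volume 0 t := by
  refine intervalIntegral.intervalIntegrable_of_integral_ne_zero ?_
  rw [integral_rpow_mul_rpow hp hq ht]
  have := Real.Gamma_pos_of_pos hp
  have := Real.Gamma_pos_of_pos hq
  have := Real.Gamma_pos_of_pos (add_pos hp hq)
  positivity

theorem absolutelyContinuousOnInterval_rpow {β : ℝ} (hβ : 0 < β) (T : ℝ) :
    AbsolutelyContinuousOnInterval (fun t : ℝ => t ^ β) 0 T := by
  have h1 : IntervalIntegrable (fun t : ℝ => t ^ (β - 1)) volume 0 T :=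
    intervalIntegral.intervalIntegrable_rpow' (by linarith)
  convert (h1.absolutelyContinuousOnInterval_intervalIntegral left_mem_uIcc).const_mul β using 2
    with t
  rw [integral_rpow (Or.inl (by linarith)), sub_add_cancel, Real.zero_rpow hβ.ne']
  field_simp
  ring

theorem caputoDifferentiableAt_rpow {β t : ℝ} (hβ₀ : 0 < β) (hβ₁ : β ≤ 1) (ht : 0 < t) :
    CaputoDifferentiableAt β (fun s : ℝ => s ^ β) t := by
  refine ⟨(Real.hasDerivAt_rpow_const (Or.inl ht.ne')).differentiableAt, fun hβ => ?_⟩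
  have hlt : β < 1 := lt_of_le_of_ne hβ₁ hβ
  refine ((intervalIntegrable_rpow_mul_rpow hβ₀ (by linarith : 0 < 1 - β) ht).const_mul β).congr_ae
    ?_
  rw [uIoc_of_le ht.le]
  filter_upwards [ae_restrict_mem measurableSet_Ioc] with τ hτ
  rw [(Real.hasDerivAt_rpow_const (Or.inl hτ.1.ne')).deriv, smul_eq_mul,
    show 1 - β - 1 = -β by ring]
  ring

theorem absolutelyContinuousOnInterval_mittagLeffler {β : ℝ} (hβ : 0 < β) (lam T : ℝ) :
    AbsolutelyContinuousOnInterval (fun t : ℝ => mittagLeffler β (-(lam * t ^ β))) 0 T :=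
  AbsolutelyContinuousOnInterval.comp_contDiff (V := fun x => mittagLeffler β (-(lam * x)))
    ((contDiff_mittagLeffler hβ).comp (by fun_prop)) (absolutelyContinuousOnInterval_rpow hβ T)

theorem caputoDifferentiableAt_mittagLeffler {β t : ℝ} (hβ₀ : 0 < β) (hβ₁ : β ≤ 1) (lam : ℝ)
    (ht : 0 < t) :
    CaputoDifferentiableAt β (fun t : ℝ => mittagLeffler β (-(lam * t ^ β))) t := by
  refine CaputoDifferentiableAt.comp_contDiff (V := fun x => mittagLeffler β (-(lam * x))) ht.le
    ((contDiff_mittagLeffler hβ₀).comp (by fun_prop)) (absolutelyContinuousOnInterval_rpow hβ₀ t)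
    ?_ (caputoDifferentiableAt_rpow hβ₀ hβ₁ ht)
  filter_upwards [ae_restrict_mem measurableSet_Ioo] with s hs
  exact (Real.hasDerivAt_rpow_const (Or.inl hs.1.ne')).differentiableAt

/-- Termwise differentiation; the constant term drops out, so the index shifts by one, and Γ(x+1) =
xΓ(x) cancels the factor (k+1)β. -/
theorem hasSum_deriv_mittagLeffler {β τ : ℝ} (hβ : 0 < β) (lam : ℝ) (hτ : 0 < τ) :
    HasSum (fun k : ℕ => (-lam) ^ (k + 1) * τ ^ ((k + 1) * β - 1) / Real.Gamma ((k + 1) * β))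
      (deriv (fun t : ℝ => mittagLeffler β (-(lam * t ^ β))) τ) := by
  set z : ℝ := -(lam * τ ^ β) with hz
  have h1 := (hasDerivAt_mittagLeffler hβ z).comp τ
    (((Real.hasDerivAt_rpow_const (p := β) (Or.inl hτ.ne')).const_mul lam).neg)
  have hs : Summable fun k : ℕ => k * z ^ (k - 1) / Real.Gamma (k * β + 1) := by
    refine Summable.of_norm_bounded (summable_deriv_mittagLeffler hβ (R := |z| + 1)
      (by linarith [abs_nonneg z])) fun k => ?_
    exact norm_deriv_mittagLeffler_term_le hβ (abs_lt.1 (by linarith)) k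
  have h2 := ((hasSum_nat_add_iff' 1).2 hs.hasSum).mul_right (-(lam * (β * τ ^ (β - 1))))
  simp only [Finset.range_one, Finset.sum_singleton, Nat.cast_zero, zero_mul, zero_div,
    sub_zero] at h2
  rw [show deriv (fun t : ℝ => mittagLeffler β (-(lam * t ^ β))) τ = _ from h1.deriv]
  convert! h2 using 2 with k
  have hG : Real.Gamma ((k + 1) * β + 1) = (k + 1) * β * Real.Gamma ((k + 1) * β) :=
    Real.Gamma_add_one (by positivity)
  have hGp : 0 < Real.Gamma ((k + 1) * β) := Real.Gamma_pos_of_pos (by positivity)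
  have hpow : τ ^ ((k + 1) * β - 1) = (τ ^ β) ^ k * τ ^ (β - 1) := by
    rw [← Real.rpow_natCast, ← Real.rpow_mul hτ.le, ← Real.rpow_add hτ]
    congr 1
    ring
  simp only [Nat.add_sub_cancel, Nat.cast_add, Nat.cast_one]
  rw [hG, hpow, hz, show -(lam * τ ^ β) = (-lam) * τ ^ β by ring, mul_pow, pow_succ]
  have : (k : ℝ) + 1 ≠ 0 := by positivity
  field_simp

/-- `E_β(-λ t ^ β)` solves the linear fractional relaxation equation. -/
theorem caputo_mittagLeffler {β t : ℝ} (hβ₀ : 0 < β) (hβ₁ : β ≤ 1) (lam : ℝ) (ht : 0 < t) :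
    caputo β (fun t : ℝ => mittagLeffler β (-(lam * t ^ β))) t =
      -lam * mittagLeffler β (-(lam * t ^ β)) := by
  rcases hβ₁.eq_or_lt with rfl | hβ₁
  · simp only [caputo, if_true, mittagLeffler_one, Real.rpow_one]
    have h : HasDerivAt (fun t : ℝ => Real.exp (-(lam * t)))
        (Real.exp (-(lam * t)) * (-(lam * 1))) t :=
      (((hasDerivAt_id t).const_mul lam).neg).exp
    rw [h.deriv]
    ring
  simp only [caputo, hβ₁.ne, if_false, smul_eq_mul]
  have hβ' : 0 < 1 - β := by linarith
  have hΓ := Real.Gamma_pos_of_pos hβ'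
  set a : ℕ → ℝ → ℝ := fun k τ => (-lam) ^ (k + 1) / Real.Gamma ((k + 1) * β) *
    (τ ^ ((k + 1) * β - 1) * (t - τ) ^ (1 - β - 1)) with ha
  have hp : ∀ k : ℕ, 0 < ((k : ℝ) + 1) * β := fun k => by positivity
  have hval : ∀ k : ℕ, ∫ τ in (0 : ℝ)..t, τ ^ (((k : ℝ) + 1) * β - 1) * (t - τ) ^ (1 - β - 1) =
      (t ^ β) ^ k * (Real.Gamma ((k + 1) * β) * Real.Gamma (1 - β) / Real.Gamma (k * β + 1)) := by
    intro k
    rw [integral_rpow_mul_rpow (hp k) hβ' ht, ← Real.rpow_natCast (t ^ β), ← Real.rpow_mul ht.le]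
    congr 3 <;> ring
  -- The beta integral sends the term of index k+1 to -λΓ(1-β) times the k-th term of the series:
  -- this is the relaxation equation termwise.
  have hI : ∀ k : ℕ, ∫ τ in (0 : ℝ)..t, a k τ =
      -lam * Real.Gamma (1 - β) * ((-(lam * t ^ β)) ^ k / Real.Gamma (k * β + 1)) := by
    intro k
    have := Real.Gamma_pos_of_pos (hp k)
    simp only [ha]
    rw [intervalIntegral.integral_const_mul, hval, show -(lam * t ^ β) = (-lam) * t ^ β by ring,
      mul_pow, pow_succ]
    field_simp
  have hint : ∀ k, IntervalIntegrable (a k) volume 0 t := fun k =>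
    (intervalIntegrable_rpow_mul_rpow (hp k) hβ' ht).const_mul _
  -- These integrals sum to a multiple of E_β(|λ|t^β), which permits exchanging sum and integral.
  have hnorm : ∀ k : ℕ, ∫ τ in (0 : ℝ)..t, ‖a k τ‖ =
      |lam| * Real.Gamma (1 - β) * ((|lam| * t ^ β) ^ k / Real.Gamma (k * β + 1)) := by
    intro k
    have hG := Real.Gamma_pos_of_pos (hp k)
    have e : ∀ τ ∈ uIcc 0 t, ‖a k τ‖ = |lam| ^ (k + 1) / Real.Gamma ((k + 1) * β) *
        (τ ^ (((k : ℝ) + 1) * β - 1) * (t - τ) ^ (1 - β - 1)) := by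
      intro τ hτ
      rw [uIcc_of_le ht.le] at hτ
      have h1 := Real.rpow_nonneg hτ.1 (((k : ℝ) + 1) * β - 1)
      have h2 := Real.rpow_nonneg (sub_nonneg.2 hτ.2) (1 - β - 1)
      simp only [ha]
      rw [norm_mul, Real.norm_of_nonneg (mul_nonneg h1 h2), norm_div, norm_pow, norm_neg,
        Real.norm_of_nonneg hG.le, Real.norm_eq_abs]
    rw [intervalIntegral.integral_congr e, intervalIntegral.integral_const_mul, hval, mul_pow,
      pow_succ]
    field_simp
  have hsum := hasSum_integral_of_summable_integral_norm (μ := volume.restrict (Ioc 0 t)) (F := a)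
    (fun k => (intervalIntegrable_iff_integrableOn_Ioc_of_le ht.le).1 (hint k)) (by
      simp only [← intervalIntegral.integral_of_le ht.le, hnorm]
      exact (summable_mittagLeffler hβ₀ _).mul_left _)
  simp only [← intervalIntegral.integral_of_le ht.le, hI] at hsum
  have hfun : ∫ τ in (0 : ℝ)..t,
      (t - τ) ^ (-β) * deriv (fun t : ℝ => mittagLeffler β (-(lam * t ^ β))) τ =
      ∫ τ in (0 : ℝ)..t, ∑' k, a k τ := by
    refine intervalIntegral.integral_congr_ae (Filter.Eventually.of_forall fun τ hτ => ?_)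
    rw [uIoc_of_le ht.le] at hτ
    rw [← ((hasSum_deriv_mittagLeffler hβ₀ lam hτ.1).mul_left _).tsum_eq]
    refine tsum_congr fun k => ?_
    simp only [ha]
    rw [show 1 - β - 1 = -β by ring]
    ring
  rw [hfun, ← hsum.tsum_eq, tsum_mul_left]
  change _ * (_ * mittagLeffler β _) = _
  field_simp

/-! ### Comparison of Mittag-Leffler functions at different rates -/

theorem caputo_sub_const_mul {f g : ℝ → ℝ} {β t : ℝ} (c : ℝ) (ht : 0 ≤ t)
    (hfa : AbsolutelyContinuousOnInterval f 0 t) (hga : AbsolutelyContinuousOnInterval g 0 t)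
    (hf : CaputoDifferentiableAt β f t) (hg : CaputoDifferentiableAt β g t) :
    CaputoDifferentiableAt β (fun s => f s - c * g s) t ∧
      caputo β (fun s => f s - c * g s) t = caputo β f t - c * caputo β g t := by
  have hd : ∀ s, DifferentiableAt ℝ f s → DifferentiableAt ℝ g s →
      HasDerivAt (fun s => f s - c * g s) (deriv f s - c * deriv g s) s :=
    fun s h1 h2 => h1.hasDerivAt.sub (h2.hasDerivAt.const_mul c)
  have hae : ∀ᵐ s ∂(volume.restrict (uIoc (0 : ℝ) t)),
      (t - s) ^ (-β) * deriv (fun s => f s - c * g s) s =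
        (t - s) ^ (-β) * deriv f s - c * ((t - s) ^ (-β) * deriv g s) := by
    rw [uIoc_of_le ht, ← restrict_Ioo_eq_restrict_Ioc]
    filter_upwards [ae_differentiableAt_of_absolutelyContinuousOnInterval ht hfa,
      ae_differentiableAt_of_absolutelyContinuousOnInterval ht hga] with s h1 h2
    rw [(hd s h1 h2).deriv]
    ring
  refine ⟨⟨(hd t hf.1 hg.1).differentiableAt, fun hβ => ?_⟩, ?_⟩
  · have h1 := hf.2 hβ
    have h2 := hg.2 hβ
    simp only [smul_eq_mul] at h1 h2 ⊢
    refine (h1.sub (h2.const_mul c)).congr_ae ?_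
    filter_upwards [hae] with s hs using hs.symm
  · by_cases hβ : β = 1
    · simp only [caputo, hβ, if_true]
      exact (hd t hf.1 hg.1).deriv
    · have h1 := hf.2 hβ
      have h2 := hg.2 hβ
      simp only [caputo, hβ, if_false, smul_eq_mul] at h1 h2 ⊢
      rw [intervalIntegral.integral_congr_ae_restrict hae,
        intervalIntegral.integral_sub h1 (h2.const_mul c), intervalIntegral.integral_const_mul]
      ring

/-- Fractional Grönwall inequality. -/
theorem le_mul_mittagLeffler {v : ℝ → ℝ} {β T lam : ℝ} (hβ₀ : 0 < β) (hβ₁ : β ≤ 1)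
    (hlam : 0 ≤ lam) (hT : 0 < T) (hv : AbsolutelyContinuousOnInterval v 0 T)
    (hc : ∀ᵐ t ∂(volume.restrict (Ioo (0 : ℝ) T)),
      CaputoDifferentiableAt β v t ∧ caputo β v t ≤ -lam * v t) :
    ∀ t ∈ Icc 0 T, v t ≤ v 0 * mittagLeffler β (-(lam * t ^ β)) := by
  have hu := absolutelyContinuousOnInterval_mittagLeffler hβ₀ lam T
  have key := nonpos_of_caputo_nonpos hβ₀ hβ₁ hT
    (w := fun s => v s - v 0 * mittagLeffler β (-(lam * s ^ β))) (hv.fun_sub (hu.const_mul (v 0)))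
    (by simp [Real.zero_rpow hβ₀.ne', mittagLeffler_zero]) (by
      filter_upwards [hc, ae_restrict_mem measurableSet_Ioo] with t ht htm
      have hsub : uIcc 0 t ⊆ uIcc 0 T := by
        rw [uIcc_of_le htm.1.le, uIcc_of_le hT.le]; exact Icc_subset_Icc_right htm.2.le
      obtain ⟨h1, h2⟩ := caputo_sub_const_mul (v 0) htm.1.le (hv.mono hsub) (hu.mono hsub) ht.1
        (caputoDifferentiableAt_mittagLeffler hβ₀ hβ₁ lam htm.1)
      refine ⟨h1, fun hpos => ?_⟩
      rw [h2, caputo_mittagLeffler hβ₀ hβ₁ lam htm.1]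
      nlinarith [ht.2, mul_nonneg hlam hpos.le])
  intro t ht
  have := key t ht
  linarith

/-- Comparison principle for w(s) = -E_β(-x s^β), which starts at -1 and satisfies D^β w = -xw; the
value at s = 1 is the claim. -/
theorem mittagLeffler_neg_nonneg {β x : ℝ} (hβ₀ : 0 < β) (hβ₁ : β ≤ 1) (hx : 0 ≤ x) :
    0 ≤ mittagLeffler β (-x) := by
  have hu := absolutelyContinuousOnInterval_mittagLeffler hβ₀ x 1
  have h0 : AbsolutelyContinuousOnInterval (fun _ : ℝ => (0 : ℝ)) 0 1 :=
    ContDiffOn.absolutelyContinuousOnInterval contDiffOn_const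
  have hz : ∀ t : ℝ, CaputoDifferentiableAt β (fun _ : ℝ => (0 : ℝ)) t ∧
      caputo β (fun _ : ℝ => (0 : ℝ)) t = 0 := fun t => by
    simp [CaputoDifferentiableAt, caputo]
  have key := nonpos_of_caputo_nonpos hβ₀ hβ₁ one_pos
    (w := fun s => 0 - 1 * mittagLeffler β (-(x * s ^ β))) (h0.fun_sub (hu.const_mul 1))
    (by simp [Real.zero_rpow hβ₀.ne', mittagLeffler_zero]) (by
      filter_upwards [ae_restrict_mem measurableSet_Ioo] with t htm
      have hsub : uIcc 0 t ⊆ uIcc (0 : ℝ) 1 := by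
        rw [uIcc_of_le htm.1.le, uIcc_of_le zero_le_one]; exact Icc_subset_Icc_right htm.2.le
      obtain ⟨h1, h2⟩ := caputo_sub_const_mul 1 htm.1.le (h0.mono hsub) (hu.mono hsub) (hz t).1
        (caputoDifferentiableAt_mittagLeffler hβ₀ hβ₁ x htm.1)
      refine ⟨h1, fun hpos => ?_⟩
      rw [h2, caputo_mittagLeffler hβ₀ hβ₁ x htm.1, (hz t).2]
      nlinarith [mul_nonneg hx hpos.le])
  have := key 1 ⟨zero_le_one, le_rfl⟩
  simp only [Real.one_rpow, mul_one] at this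
  linarith

/-- By nonnegativity, the solution with rate y is a subsolution for the smaller rate x. -/
theorem mittagLeffler_neg_antitone {β x y : ℝ} (hβ₀ : 0 < β) (hβ₁ : β ≤ 1) (hx : 0 ≤ x)
    (hxy : x ≤ y) : mittagLeffler β (-y) ≤ mittagLeffler β (-x) := by
  have h := le_mul_mittagLeffler hβ₀ hβ₁ hx one_pos
    (absolutelyContinuousOnInterval_mittagLeffler hβ₀ y 1) (by
      filter_upwards [ae_restrict_mem measurableSet_Ioo] with t htm
      refine ⟨caputoDifferentiableAt_mittagLeffler hβ₀ hβ₁ y htm.1, ?_⟩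
      rw [caputo_mittagLeffler hβ₀ hβ₁ y htm.1]
      have h1 : 0 ≤ y * t ^ β := mul_nonneg (hx.trans hxy) (Real.rpow_nonneg htm.1.le _)
      nlinarith [mittagLeffler_neg_nonneg hβ₀ hβ₁ h1]) 1 ⟨zero_le_one, le_rfl⟩
  simpa [Real.zero_rpow hβ₀.ne', mittagLeffler_zero] using h

theorem mittagLeffler_neg_le_one {β x : ℝ} (hβ₀ : 0 < β) (hβ₁ : β ≤ 1) (hx : 0 ≤ x) :
    mittagLeffler β (-x) ≤ 1 := by
  simpa [mittagLeffler_zero] using mittagLeffler_neg_antitone hβ₀ hβ₁ le_rfl hx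

/-- In the relaxation equation at t = 1, the kernel is at least 1 and the derivative nonpositive, so
-Γ(1-β) x E_β(-x) ≤ E_β(-x) - 1. -/
theorem one_le_mul_mittagLeffler_neg {β x : ℝ} (hβ₀ : 0 < β) (hβ₁ : β < 1) (hx : 0 ≤ x) :
    1 ≤ (1 + Real.Gamma (1 - β) * x) * mittagLeffler β (-x) := by
  have hΓ := Real.Gamma_pos_of_pos (by linarith : 0 < 1 - β)
  have hac := absolutelyContinuousOnInterval_mittagLeffler hβ₀ x 1
  have hcd := caputoDifferentiableAt_mittagLeffler hβ₀ hβ₁.le x one_pos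
  have hc := caputo_mittagLeffler hβ₀ hβ₁.le x one_pos
  have hi := hcd.2 hβ₁.ne
  simp only [caputo, hβ₁.ne, if_false, smul_eq_mul] at hc hi
  have hdn : ∀ τ ∈ Ioo (0 : ℝ) 1,
      deriv (fun t : ℝ => mittagLeffler β (-(x * t ^ β))) τ ≤ 0 := by
    intro τ hτ
    have hanti : AntitoneOn (fun t : ℝ => mittagLeffler β (-(x * t ^ β))) (Ici 0) := by
      intro a ha b hb hab
      have ha' : (0 : ℝ) ≤ a := ha
      have := Real.rpow_nonneg ha' β
      exact mittagLeffler_neg_antitone hβ₀ hβ₁.le (by positivity) (by gcongr)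
    rw [← derivWithin_of_mem_nhds (Ici_mem_nhds hτ.1)]
    exact hanti.derivWithin_nonpos
  have hmono := intervalIntegral.integral_mono_on_of_le_Ioo zero_le_one hi
    hac.intervalIntegrable_deriv (fun τ hτ => by
      have h1 : 1 ≤ (1 - τ) ^ (-β) :=
        Real.one_le_rpow_of_pos_of_le_one_of_nonpos (by linarith [hτ.2]) (by linarith [hτ.1])
          (by linarith)
      nlinarith [hdn τ hτ])
  rw [hac.integral_deriv_eq_sub] at hmono
  simp only [Real.zero_rpow hβ₀.ne', Real.one_rpow, mul_one, mul_zero, neg_zero,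
    mittagLeffler_zero] at hmono hc
  rw [inv_mul_eq_iff_eq_mul₀ hΓ.ne'] at hc
  rw [hc] at hmono
  linarith

/-- The relaxation equation is integrated over [0,1]: the mean of E_β(-x t^β) is at least E_β(-x),
and its fractional integral loses at most ∫(1-τ)^(-β) = 1/(1-β). -/
theorem mul_mittagLeffler_neg_le {β x : ℝ} (hβ₀ : 0 < β) (hβ₁ : β < 1) (hx : 0 ≤ x) :
    x * Real.Gamma (1 - β) * (1 - β) * mittagLeffler β (-x) ≤ 1 := by
  have hβ' : 0 < 1 - β := by linarith
  have hΓ := Real.Gamma_pos_of_pos hβ'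
  have hac := absolutelyContinuousOnInterval_mittagLeffler hβ₀ x 1
  have hI := integral_integral_kernel_mul_deriv hβ₁ one_pos hac
  have hu : ∀ t ∈ Icc (0 : ℝ) 1, mittagLeffler β (-x) ≤ mittagLeffler β (-(x * t ^ β)) ∧
      0 ≤ mittagLeffler β (-(x * t ^ β)) := by
    intro t ht
    have h1 : 0 ≤ x * t ^ β := mul_nonneg hx (Real.rpow_nonneg ht.1 _)
    have h2 : t ^ β ≤ 1 := Real.rpow_le_one ht.1 ht.2 hβ₀.le
    exact ⟨mittagLeffler_neg_antitone hβ₀ hβ₁.le h1 (by nlinarith),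
      mittagLeffler_neg_nonneg hβ₀ hβ₁.le h1⟩
  have e1 : ∫ t in (0 : ℝ)..1, ∫ τ in (0 : ℝ)..t,
      (t - τ) ^ (-β) * deriv (fun t : ℝ => mittagLeffler β (-(x * t ^ β))) τ =
      ∫ t in (0 : ℝ)..1, -(Real.Gamma (1 - β) * x) * mittagLeffler β (-(x * t ^ β)) := by
    refine intervalIntegral.integral_congr_ae (Filter.Eventually.of_forall fun t ht => ?_)
    rw [uIoc_of_le zero_le_one] at ht
    have hc := caputo_mittagLeffler hβ₀ hβ₁.le x ht.1
    simp only [caputo, hβ₁.ne, if_false, smul_eq_mul] at hc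
    rw [inv_mul_eq_iff_eq_mul₀ hΓ.ne'] at hc
    rw [hc]
    ring
  rw [e1, intervalIntegral.integral_const_mul] at hI
  have hui : IntervalIntegrable (fun t : ℝ => mittagLeffler β (-(x * t ^ β))) volume 0 1 :=
    hac.continuousOn.intervalIntegrable
  have hlow : mittagLeffler β (-x) ≤ ∫ t in (0 : ℝ)..1, mittagLeffler β (-(x * t ^ β)) := by
    have := intervalIntegral.integral_mono_on zero_le_one
      (intervalIntegrable_const (c := mittagLeffler β (-x))) hui fun t ht => (hu t ht).1
    simpa using this
  have hk := intervalIntegrable_kernel hβ₁ 1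
  have hup : -(1 - β)⁻¹ ≤ ∫ τ in (0 : ℝ)..1, (mittagLeffler β (-(x * τ ^ β)) -
      mittagLeffler β (-(x * (0 : ℝ) ^ β))) * (1 - τ) ^ (-β) := by
    have hkv : ∫ τ in (0 : ℝ)..1, (1 - τ) ^ (-β) = (1 - β)⁻¹ := by
      rw [intervalIntegral.integral_comp_sub_left (fun s : ℝ => s ^ (-β)),
        integral_rpow (Or.inl (by linarith))]
      rw [show -β + 1 = 1 - β by ring]
      simp [Real.zero_rpow hβ'.ne']
    rw [← hkv, ← intervalIntegral.integral_neg]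
    refine intervalIntegral.integral_mono_on zero_le_one hk.neg
      (hk.continuousOn_mul (hac.continuousOn.sub continuousOn_const)) fun τ hτ => ?_
    have h1 := (hu τ hτ).2
    have h2 : 0 ≤ (1 - τ) ^ (-β) := Real.rpow_nonneg (sub_nonneg.2 hτ.2) _
    simp only [Real.zero_rpow hβ₀.ne', mul_zero, neg_zero, mittagLeffler_zero]
    nlinarith
  rw [← hI] at hup
  have h3 : Real.Gamma (1 - β) * x * mittagLeffler β (-x) ≤ (1 - β)⁻¹ := by
    have : 0 ≤ Real.Gamma (1 - β) * x := by positivity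
    nlinarith [mul_le_mul_of_nonneg_left hlow this]
  calc _ = (1 - β) * (Real.Gamma (1 - β) * x * mittagLeffler β (-x)) := by ring
    _ ≤ (1 - β) * (1 - β)⁻¹ := by gcongr
    _ = 1 := mul_inv_cancel₀ hβ'.ne'

/-- For `β < 1` the function `x ↦ E_β(-x)` decays algebraically, so that slowing down the rate
costs only a constant factor. -/
theorem exists_mittagLeffler_neg_mul_le {β : ℝ} (hβ₀ : 0 < β) (hβ₁ : β < 1) :
    ∃ C : ℝ, 0 ≤ C ∧ ∀ κ x : ℝ, 0 < κ → κ ≤ 1 → 0 ≤ x →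
      mittagLeffler β (-(κ * x)) ≤ C / κ * mittagLeffler β (-x) := by
  have hβ' : 0 < 1 - β := by linarith
  have hΓ := Real.Gamma_pos_of_pos hβ'
  set G := Real.Gamma (1 - β) with hG
  refine ⟨(1 + G) * (1 + (G * (1 - β))⁻¹), by positivity, fun κ x hκ hκ1 hx => ?_⟩
  have hE := mittagLeffler_neg_nonneg hβ₀ hβ₁.le hx
  have hl := one_le_mul_mittagLeffler_neg hβ₀ hβ₁ hx
  rw [← hG] at hl
  have hκx : 0 ≤ κ * x := by positivity
  have h1 := mittagLeffler_neg_le_one hβ₀ hβ₁.le hκx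
  have hinv : 0 < (G * (1 - β))⁻¹ := by positivity
  have hgoal : κ * mittagLeffler β (-(κ * x)) ≤
      (1 + G) * (1 + (G * (1 - β))⁻¹) * mittagLeffler β (-x) := by
    -- For x ≤ 1, E_β(-x) is bounded below; for x ≥ 1, the lower bound at x and the upper bound at
    -- κx are both of order 1/x.
    rcases le_total x 1 with hx1 | hx1
    · have h2 : 1 ≤ (1 + G) * mittagLeffler β (-x) := hl.trans (by gcongr; nlinarith)
      have h3 : κ * mittagLeffler β (-(κ * x)) ≤ 1 := by
        nlinarith [mittagLeffler_neg_nonneg hβ₀ hβ₁.le hκx]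
      nlinarith [mul_nonneg hinv.le (by linarith : 0 ≤ (1 + G) * mittagLeffler β (-x))]
    · have h2 : 1 ≤ x * ((1 + G) * mittagLeffler β (-x)) := hl.trans (by
        rw [← mul_assoc]; gcongr; nlinarith)
      have h3 := mul_mittagLeffler_neg_le hβ₀ hβ₁ hκx
      rw [← hG] at h3
      have h4 : x * (κ * mittagLeffler β (-(κ * x))) ≤ (G * (1 - β))⁻¹ := by
        rw [← one_div, le_div_iff₀ (by positivity)]
        linarith
      have h5 : x * (κ * mittagLeffler β (-(κ * x))) ≤
          x * ((1 + G) * (1 + (G * (1 - β))⁻¹) * mittagLeffler β (-x)) := by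
        nlinarith [mul_le_mul_of_nonneg_left h2 hinv.le]
      exact le_of_mul_le_mul_left h5 (by linarith)
  rw [div_mul_eq_mul_div, le_div_iff₀ hκ]
  linarith

/-! ### Input-convex networks -/

/-- Without cases, regularity and bounds of σ reduce to those of the squared positive part. -/
theorem smoothReLU_eq {δ : ℝ} (hδ : 0 < δ) (x : ℝ) :
    smoothReLU δ x = (max x 0 ^ 2 - max (x - δ) 0 ^ 2) / (2 * δ) := by
  unfold smoothReLU
  split_ifs with h1 h2
  · rw [max_eq_right h1, max_eq_right (by linarith)]
    simp
  · rw [max_eq_left (by linarith), max_eq_right (by linarith)]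
    simp
  · rw [max_eq_left (by linarith), max_eq_left (by linarith)]
    field_simp
    ring

theorem hasDerivAt_smoothReLU {δ : ℝ} (hδ : 0 < δ) (x : ℝ) :
    HasDerivAt (smoothReLU δ) ((max x 0 - max (x - δ) 0) / δ) x := by
  rw [funext (smoothReLU_eq hδ)]
  have h := ((hasDerivAt_sq_max_zero x).sub
    ((hasDerivAt_sq_max_zero (x - δ)).comp_sub_const x δ)).div_const (2 * δ)
  convert! h using 1
  field_simp

theorem contDiff_smoothReLU {δ : ℝ} (hδ : 0 < δ) : ContDiff ℝ 1 (smoothReLU δ) := by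
  rw [funext (smoothReLU_eq hδ)]
  exact (contDiff_sq_max_zero.sub
    (contDiff_sq_max_zero.comp (contDiff_id.sub contDiff_const))).div_const _

theorem abs_smoothReLU_sub_le {δ : ℝ} (hδ : 0 < δ) (x y : ℝ) :
    |smoothReLU δ x - smoothReLU δ y| ≤ |x - y| := by
  have hb : ∀ z ∈ (univ : Set ℝ), ‖(max z 0 - max (z - δ) 0) / δ‖ ≤ 1 := by
    intro z _
    rw [Real.norm_eq_abs, abs_div, abs_of_pos hδ, div_le_one hδ, abs_le]
    constructor
    · linarith [max_le_max_right (0 : ℝ) (by linarith : z - δ ≤ z)]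
    · have : max z 0 ≤ max (z - δ) 0 + δ :=
        max_le (by linarith [le_max_left (z - δ) 0]) (by linarith [le_max_right (z - δ) 0])
      linarith
  simpa using convex_univ.norm_image_sub_le_of_norm_hasDerivWithin_le
    (fun z _ => (hasDerivAt_smoothReLU hδ z).hasDerivWithinAt) hb (mem_univ y) (mem_univ x)

theorem smoothReLU_nonneg {δ : ℝ} (hδ : 0 < δ) (x : ℝ) : 0 ≤ smoothReLU δ x := by
  rw [smoothReLU_eq hδ]
  have h : max (x - δ) 0 ≤ max x 0 := max_le_max_right _ (by linarith)
  have := pow_le_pow_left₀ (le_max_right (x - δ) 0) h 2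
  exact div_nonneg (by linarith) (by linarith)

theorem smoothReLU_le_sq {δ : ℝ} (hδ : 0 < δ) (x : ℝ) : smoothReLU δ x ≤ x ^ 2 / (2 * δ) := by
  rw [smoothReLU_eq hδ]
  gcongr
  have h : max x 0 ^ 2 ≤ x ^ 2 := by
    rcases le_total x 0 with h | h
    · rw [max_eq_right h]; nlinarith
    · rw [max_eq_left h]
  linarith [sq_nonneg (max (x - δ) 0)]

/-- Multiplication of a matrix with a vector, as a continuous linear map. -/
noncomputable def mulVecCLM {m n : Type*} [Fintype m] [Fintype n] (M : Matrix m n ℝ) :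
    (n → ℝ) →L[ℝ] (m → ℝ) :=
  LinearMap.toContinuousLinearMap M.mulVecLin

theorem ICNN.contDiff_layer {N d : ℕ} (net : ICNN N d) {δ : ℝ} (hδ : 0 < δ) (i : ℕ) :
    ContDiff ℝ 1 fun U => net.layer δ U i := by
  have hW : ∀ i, ContDiff ℝ 1 fun U : Feature N d => (net.W i).mulVec U.ofLp := fun i =>
    ((mulVecCLM (net.W i)).comp
      (PiLp.continuousLinearEquiv 2 ℝ fun _ : Fin N × Fin d => ℝ).toContinuousLinearMap).contDiff
  induction i with
  | zero =>
    refine contDiff_pi.2 fun j => (contDiff_smoothReLU hδ).comp ?_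
    exact (contDiff_pi.1 (hW 0) j).add contDiff_const
  | succ i ih =>
    refine contDiff_pi.2 fun j => (contDiff_smoothReLU hδ).comp ?_
    have hP : ContDiff ℝ 1 fun U : Feature N d => (net.P i).mulVec (net.layer δ U i) :=
      (mulVecCLM (net.P i)).contDiff.comp ih
    exact ((contDiff_pi.1 hP j).add (contDiff_pi.1 (hW (i + 1)) j)).add contDiff_const

theorem ICNN.exists_norm_layer_sub_le {N d : ℕ} (net : ICNN N d) {δ : ℝ} (hδ : 0 < δ) (i : ℕ) :
    ∃ K : ℝ, 0 ≤ K ∧ ∀ U U' : Feature N d,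
      ‖net.layer δ U i - net.layer δ U' i‖ ≤ K * ‖U - U'‖ := by
  have hW : ∀ i, ∃ K : ℝ, 0 ≤ K ∧ ∀ (U U' : Feature N d) j,
      |(net.W i).mulVec U.ofLp j - (net.W i).mulVec U'.ofLp j| ≤ K * ‖U - U'‖ := by
    intro i
    set A := (mulVecCLM (net.W i)).comp
      (PiLp.continuousLinearEquiv 2 ℝ fun _ : Fin N × Fin d => ℝ).toContinuousLinearMap
    refine ⟨‖A‖, norm_nonneg _, fun U U' j => ?_⟩
    refine le_trans ?_ (A.le_opNorm (U - U'))
    rw [map_sub]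
    exact norm_le_pi_norm (A U - A U') j
  induction i with
  | zero =>
    obtain ⟨K, hK, h⟩ := hW 0
    refine ⟨K, hK, fun U U' => (pi_norm_le_iff_of_nonneg (by positivity)).2 fun j => ?_⟩
    refine (abs_smoothReLU_sub_le hδ _ _).trans (le_trans (le_of_eq ?_) (h U U' j))
    congr 1
    ring
  | succ i ih =>
    obtain ⟨K, hK, h⟩ := hW (i + 1)
    obtain ⟨K', hK', h'⟩ := ih
    refine ⟨‖mulVecCLM (net.P i)‖ * K' + K, by positivity, fun U U' =>
      (pi_norm_le_iff_of_nonneg (by positivity)).2 fun j => ?_⟩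
    refine (abs_smoothReLU_sub_le hδ _ _).trans ?_
    have h1 : |(net.P i).mulVec (net.layer δ U i) j - (net.P i).mulVec (net.layer δ U' i) j| ≤
        ‖mulVecCLM (net.P i)‖ * (K' * ‖U - U'‖) := by
      refine le_trans ?_ (mul_le_mul_of_nonneg_left (h' U U') (norm_nonneg _))
      refine le_trans ?_ ((mulVecCLM (net.P i)).le_opNorm _)
      rw [map_sub]
      exact norm_le_pi_norm (mulVecCLM (net.P i) (net.layer δ U i) -
        mulVecCLM (net.P i) (net.layer δ U' i)) j
    calc _ = |((net.P i).mulVec (net.layer δ U i) j - (net.P i).mulVec (net.layer δ U' i) j) +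
          ((net.W (i + 1)).mulVec U.ofLp j - (net.W (i + 1)).mulVec U'.ofLp j)| := by
          congr 1; ring
      _ ≤ _ := abs_add_le _ _
      _ ≤ ‖mulVecCLM (net.P i)‖ * (K' * ‖U - U'‖) + K * ‖U - U'‖ := add_le_add h1 (h U U' j)
      _ = _ := by ring

/-- The network is K-Lipschitz and σ(x) ≤ x²/(2δ), so the network term is at most K²‖U‖²/(2δ); since
σ ≥ 0, α₁ = 1 works. -/
theorem ICNN.exists_isQuadraticLyapunov {N d : ℕ} (net : ICNN N d) {δ : ℝ} (hδ : 0 < δ) :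
    ∃ α₁ α₂ : ℝ, 0 < α₁ ∧ 0 < α₂ ∧ IsQuadraticLyapunov (net.lyapunov δ) α₁ α₂ := by
  obtain ⟨K, hK, h⟩ := net.exists_norm_layer_sub_le hδ net.depth
  refine ⟨1, 1 + K ^ 2 / (2 * δ), one_pos, by positivity, ?_, fun U => ⟨?_, ?_⟩⟩
  · have ho : ContDiff ℝ 1 (net.output δ) := contDiff_pi.1 (net.contDiff_layer hδ net.depth) _
    exact ((contDiff_smoothReLU hδ).comp (ho.sub contDiff_const)).add (contDiff_norm_sq ℝ)
  · have := smoothReLU_nonneg hδ (net.output δ U - net.output δ 0)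
    simp only [ICNN.lyapunov]
    linarith
  · have h1 : |net.output δ U - net.output δ 0| ≤ K * ‖U‖ := by
      have := (norm_le_pi_norm _ (Fin.cast net.width_depth.symm 0)).trans (h U 0)
      rwa [sub_zero] at this
    have h2 : (net.output δ U - net.output δ 0) ^ 2 ≤ (K * ‖U‖) ^ 2 := sq_le_sq' (by
      linarith [neg_le_of_abs_le h1]) (le_of_abs_le h1)
    have h3 := smoothReLU_le_sq hδ (net.output δ U - net.output δ 0)
    have h4 : (net.output δ U - net.output δ 0) ^ 2 / (2 * δ) ≤ (K * ‖U‖) ^ 2 / (2 * δ) := by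
      gcongr
    simp only [ICNN.lyapunov]
    calc _ ≤ (K * ‖U‖) ^ 2 / (2 * δ) + ‖U‖ ^ 2 := by linarith
      _ = _ := by ring

/-! ### Decay along the projected flow -/

section Flow

variable {N d p : ℕ} {β α₁ α₂ α₃ T : ℝ} {F : ℝ → Feature N d → Feature N d}
  {V : Feature N d → ℝ} {U : ℝ → Feature N d}

theorem IsQuadraticLyapunov.nonneg (hα₁ : 0 < α₁) (hV : IsQuadraticLyapunov V α₁ α₂)
    (x : Feature N d) : 0 ≤ V x :=
  le_trans (by positivity) (hV.2 x).1

theorem IsQuadraticLyapunov.eq_zero_iff (hα₁ : 0 < α₁) (hV : IsQuadraticLyapunov V α₁ α₂)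
    (x : Feature N d) : V x = 0 ↔ x = 0 := by
  refine ⟨fun h => ?_, fun h => ?_⟩
  · have h1 := (hV.2 x).1
    rw [h] at h1
    by_contra hx
    have : 0 < ‖x‖ := norm_pos_iff.2 hx
    have : 0 < α₁ * ‖x‖ ^ 2 := by positivity
    linarith
  · have h1 := hV.2 x
    simp only [h, norm_zero, ne_eq, OfNat.ofNat_ne_zero, not_false_eq_true, zero_pow,
      mul_zero] at h1 ⊢
    exact le_antisymm h1.2 h1.1

theorem IsQuadraticLyapunov.sq_norm_le (hα₁ : 0 < α₁) (hV : IsQuadraticLyapunov V α₁ α₂)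
    (x : Feature N d) : ‖x‖ ^ 2 ≤ V x / α₁ := by
  rw [le_div_iff₀ hα₁, mul_comm]
  exact (hV.2 x).1

/-- Membership of the velocity in `decreaseSet` is tested on the trajectory `U` itself. -/
theorem IsProjectedSolution.caputo_le (hV : ContDiff ℝ 1 V)
    (hU : IsProjectedSolution β α₃ p F V T U) :
    AbsolutelyContinuousOnInterval (fun s => V (U s)) 0 T ∧
      ∀ᵐ t ∂(volume.restrict (Ioo (0 : ℝ) T)), CaputoDifferentiableAt β (fun s => V (U s)) t ∧
        caputo β (fun s => V (U s)) t ≤ -α₃ * ‖U t‖ ^ p := by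
  refine ⟨hU.1.comp_contDiff hV, ?_⟩
  filter_upwards [hU.2, ae_restrict_mem measurableSet_Ioo] with t ht htm
  have hac : AbsolutelyContinuousOnInterval U 0 t := hU.1.mono (by
    rw [uIcc_of_le htm.1.le, uIcc_of_le (htm.1.trans htm.2).le]
    exact Icc_subset_Icc_right htm.2.le)
  refine ⟨CaputoDifferentiableAt.comp_contDiff htm.1.le hV hac ?_ ht.1,
    ht.2.1 U hac ht.1 rfl rfl⟩
  filter_upwards [ae_mono (Measure.restrict_mono (Ioo_subset_Ioo_right htm.2.le) le_rfl) hU.2]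
    with s hs using hs.1.1

theorem IsProjectedSolution.le_mittagLeffler_of_two (hβ₀ : 0 < β) (hβ₁ : β ≤ 1) (hα₃ : 0 < α₃)
    (hα₂ : 0 < α₂) (hV : IsQuadraticLyapunov V α₁ α₂) (hT : 0 < T)
    (hU : IsProjectedSolution β α₃ 2 F V T U) :
    ∀ t ∈ Icc (0 : ℝ) T, V (U t) ≤ V (U 0) * mittagLeffler β (-(α₃ / α₂ * t ^ β)) := by
  obtain ⟨hac, hc⟩ := hU.caputo_le hV.1
  refine le_mul_mittagLeffler (v := fun s => V (U s)) hβ₀ hβ₁ (by positivity) hT hac ?_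
  filter_upwards [hc] with t ht
  refine ⟨ht.1, ht.2.trans ?_⟩
  have h1 : α₃ / α₂ * V (U t) ≤ α₃ / α₂ * (α₂ * ‖U t‖ ^ 2) := by
    gcongr
    exact (hV.2 _).2
  have h2 : α₃ / α₂ * (α₂ * ‖U t‖ ^ 2) = α₃ * ‖U t‖ ^ 2 := by field_simp
  linarith

theorem IsProjectedSolution.lyapunov_le_initial (hβ₀ : 0 < β) (hβ₁ : β ≤ 1) (hα₃ : 0 < α₃)
    (hV : ContDiff ℝ 1 V) (hT : 0 < T) (hU : IsProjectedSolution β α₃ p F V T U) :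
    ∀ t ∈ Icc (0 : ℝ) T, V (U t) ≤ V (U 0) := by
  obtain ⟨hac, hc⟩ := hU.caputo_le hV
  -- Grönwall with rate 0, where E_β(0) = 1.
  have h := le_mul_mittagLeffler (v := fun s => V (U s)) hβ₀ hβ₁ le_rfl hT hac (by
    filter_upwards [hc] with t ht
    refine ⟨ht.1, ht.2.trans ?_⟩
    have : 0 ≤ α₃ * ‖U t‖ ^ p := by positivity
    linarith)
  simpa [mittagLeffler_zero] using h

theorem IsProjectedSolution.le_mittagLeffler_of_one (hβ₀ : 0 < β) (hβ₁ : β ≤ 1) (hα₃ : 0 < α₃)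
    (hα₁ : 0 < α₁) (hα₂ : 0 < α₂) (hV : IsQuadraticLyapunov V α₁ α₂) (hT : 0 < T)
    (hU : IsProjectedSolution β α₃ 1 F V T U) :
    ∀ t ∈ Icc (0 : ℝ) T, V (U t) ≤ V (U 0) *
      mittagLeffler β (-(α₃ / (α₂ * max 1 (Real.sqrt (V (U 0) / α₁))) * t ^ β)) := by
  obtain ⟨hac, hc⟩ := hU.caputo_le hV.1
  -- A bound on ‖U‖ for all times, by monotonicity; the maximum with 1 keeps it positive when U(0) =
  -- 0.
  set K := max 1 (Real.sqrt (V (U 0) / α₁)) with hK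
  have hKpos : 0 < K := lt_of_lt_of_le one_pos (le_max_left _ _)
  refine le_mul_mittagLeffler (v := fun s => V (U s)) hβ₀ hβ₁ (by positivity) hT hac ?_
  filter_upwards [hc, ae_restrict_mem measurableSet_Ioo] with t ht htm
  refine ⟨ht.1, ht.2.trans ?_⟩
  have hle := hU.lyapunov_le_initial hβ₀ hβ₁ hα₃ hV.1 hT t (Ioo_subset_Icc_self htm)
  have hn : ‖U t‖ ≤ K := by
    refine le_trans (Real.le_sqrt_of_sq_le ?_) (le_max_right _ _)
    exact (hV.sq_norm_le hα₁ (U t)).trans (by gcongr)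
  have h1 : V (U t) ≤ α₂ * K * ‖U t‖ := by
    refine (hV.2 (U t)).2.trans ?_
    rw [sq, mul_assoc]
    gcongr
  have h2 : α₃ / (α₂ * K) * V (U t) ≤ α₃ / (α₂ * K) * (α₂ * K * ‖U t‖) := by gcongr
  have h3 : α₃ / (α₂ * K) * (α₂ * K * ‖U t‖) = α₃ * ‖U t‖ := by field_simp
  rw [pow_one]
  linarith

/-- For the ordinary derivative the linear constraint makes `√V` decrease at a constant rate, so
that solutions reach the origin in finite time. -/
theorem IsProjectedSolution.le_sq_max_of_one (hα₁ : 0 < α₁) (hα₂ : 0 < α₂) (hα₃ : 0 < α₃)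
    (hV : IsQuadraticLyapunov V α₁ α₂) (hT : 0 < T) (hU : IsProjectedSolution 1 α₃ 1 F V T U) :
    ∀ t ∈ Icc (0 : ℝ) T,
      V (U t) ≤ max (Real.sqrt (V (U 0)) - α₃ / Real.sqrt α₂ / 2 * t) 0 ^ 2 := by
  obtain ⟨hac, hc⟩ := hU.caputo_le hV.1
  set c := α₃ / Real.sqrt α₂ with hcdef
  have hα₂' : 0 < Real.sqrt α₂ := Real.sqrt_pos.2 hα₂
  have hcpos : 0 < c := by positivity
  set a := Real.sqrt (V (U 0)) with ha
  -- The comparison function solves s' = -c√s, while v' ≤ -α₃‖U‖ ≤ -c√v.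
  have hs : ∀ t, HasDerivAt (fun s : ℝ => max (a - c / 2 * s) 0 ^ 2)
      (-c * max (a - c / 2 * t) 0) t := by
    intro t
    have h1 : HasDerivAt (fun s : ℝ => a - c / 2 * s) (-(c / 2 * 1)) t :=
      ((hasDerivAt_id t).const_mul _).const_sub a
    refine ((hasDerivAt_sq_max_zero _).comp t h1).congr_deriv ?_
    ring
  have hsC : ContDiff ℝ 1 fun s : ℝ => max (a - c / 2 * s) 0 ^ 2 :=
    contDiff_sq_max_zero.comp (by fun_prop : ContDiff ℝ 1 fun s : ℝ => a - c / 2 * s)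
  have hsac : ∀ T, AbsolutelyContinuousOnInterval (fun s : ℝ => max (a - c / 2 * s) 0 ^ 2) 0 T :=
    fun T => hsC.contDiffOn.absolutelyContinuousOnInterval
  have key := nonpos_of_caputo_nonpos (β := 1) one_pos le_rfl hT
    (w := fun s => V (U s) - 1 * max (a - c / 2 * s) 0 ^ 2) (hac.fun_sub ((hsac T).const_mul 1))
    (by
      rw [mul_zero, sub_zero, max_eq_left (Real.sqrt_nonneg _),
        Real.sq_sqrt (hV.nonneg hα₁ _), one_mul, sub_self]) (by
      filter_upwards [hc, ae_restrict_mem measurableSet_Ioo] with t ht htm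
      have hsub : uIcc 0 t ⊆ uIcc 0 T := by
        rw [uIcc_of_le htm.1.le, uIcc_of_le hT.le]; exact Icc_subset_Icc_right htm.2.le
      obtain ⟨h1, h2⟩ := caputo_sub_const_mul 1 htm.1.le (hac.mono hsub) (hsac t) ht.1
        ⟨(hs t).differentiableAt, fun h => absurd rfl h⟩
      refine ⟨h1, fun hpos => ?_⟩
      have h3 : caputo 1 (fun s : ℝ => max (a - c / 2 * s) 0 ^ 2) t =
          -c * max (a - c / 2 * t) 0 := by simp [caputo, (hs t).deriv]
      rw [h2, h3]
      have h4 : max (a - c / 2 * t) 0 ≤ Real.sqrt (V (U t)) :=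
        Real.le_sqrt_of_sq_le (by linarith)
      have h5 : Real.sqrt (V (U t)) ≤ Real.sqrt α₂ * ‖U t‖ := by
        rw [← Real.sqrt_sq (norm_nonneg (U t)), ← Real.sqrt_mul hα₂.le]
        exact Real.sqrt_le_sqrt (hV.2 _).2
      have h6 : c * max (a - c / 2 * t) 0 ≤ c * (Real.sqrt α₂ * ‖U t‖) := by
        gcongr
        exact h4.trans h5
      have h7 : c * (Real.sqrt α₂ * ‖U t‖) = α₃ * ‖U t‖ := by
        rw [hcdef]; field_simp
      have h8 := ht.2
      rw [pow_one] at h8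
      linarith)
  intro t ht
  have := key t ht
  linarith

/-- Either V has already reached 0, or t ≤ (2α₂/α₃)‖U(0)‖; then the two exponentials multiply to at
least 1 and monotonicity of V suffices. -/
theorem IsProjectedSolution.le_exp_of_one (hα₁ : 0 < α₁) (hα₂ : 0 < α₂) (hα₃ : 0 < α₃)
    (hV : IsQuadraticLyapunov V α₁ α₂) (hT : 0 < T) (hU : IsProjectedSolution 1 α₃ 1 F V T U)
    {lam : ℝ} (hlam : 0 < lam) :
    ∀ t ∈ Icc (0 : ℝ) T,
      V (U t) ≤ V (U 0) * Real.exp (lam * (2 * α₂ / α₃ * ‖U 0‖)) * Real.exp (-(lam * t)) := by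
  intro t ht
  have hα₂' : 0 < Real.sqrt α₂ := Real.sqrt_pos.2 hα₂
  have h := hU.le_sq_max_of_one hα₁ hα₂ hα₃ hV hT t ht
  have h0 := hV.nonneg hα₁ (U 0)
  rcases le_or_gt (Real.sqrt (V (U 0)) - α₃ / Real.sqrt α₂ / 2 * t) 0 with h1 | h1
  · rw [max_eq_right h1] at h
    refine h.trans ?_
    simp only [ne_eq, OfNat.ofNat_ne_zero, not_false_eq_true, zero_pow]
    positivity
  · have hle := hU.lyapunov_le_initial one_pos le_rfl hα₃ hV.1 hT t ht
    have h5 : Real.sqrt (V (U 0)) ≤ Real.sqrt α₂ * ‖U 0‖ := by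
      rw [← Real.sqrt_sq (norm_nonneg (U 0)), ← Real.sqrt_mul hα₂.le]
      exact Real.sqrt_le_sqrt (hV.2 _).2
    have h6 : α₃ / Real.sqrt α₂ / 2 * t ≤ Real.sqrt α₂ * ‖U 0‖ := by linarith
    have h7 : t ≤ 2 * α₂ / α₃ * ‖U 0‖ := by
      rw [div_div, div_mul_eq_mul_div, div_le_iff₀ (by positivity)] at h6
      rw [div_mul_eq_mul_div, le_div_iff₀ hα₃]
      have e : Real.sqrt α₂ * ‖U 0‖ * (Real.sqrt α₂ * 2) = 2 * α₂ * ‖U 0‖ := by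
        linear_combination 2 * ‖U 0‖ * Real.mul_self_sqrt hα₂.le
      linarith
    rw [mul_assoc, ← Real.exp_add]
    refine hle.trans (le_mul_of_one_le_right h0 (Real.one_le_exp ?_))
    nlinarith [mul_le_mul_of_nonneg_left h7 hlam.le]

theorem norm_le_rpow_half {x : Feature N d} {y : ℝ} (h : ‖x‖ ^ 2 ≤ y) :
    ‖x‖ ≤ y ^ (1 / 2 : ℝ) := by
  rw [← Real.sqrt_eq_rpow]
  exact Real.le_sqrt_of_sq_le h

/-- Taking m = g(‖·‖) with g of class C¹ makes m locally Lipschitz; the exponent b = 1/2 undoes the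
square. -/
theorem isMittagLefflerStable_zero_of_sq_norm_le {lam : ℝ} {g : ℝ → ℝ} (hlam : 0 < lam)
    (hg : ContDiff ℝ 1 g) (hg0 : g 0 = 0) (hgn : ∀ r, 0 ≤ r → 0 ≤ g r)
    (h : ∀ (T : ℝ) (U : ℝ → Feature N d), 0 < T → IsProjectedSolution β α₃ p F V T U →
      ∀ t ∈ Icc (0 : ℝ) T, ‖U t‖ ^ 2 ≤ g ‖U 0‖ * mittagLeffler β (-(lam * t ^ β))) :
    IsMittagLefflerStable β α₃ p F V 0 := by
  refine ⟨lam, 1 / 2, fun x => g ‖x‖, hlam, by norm_num, by simp [hg0],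
    fun x => hgn _ (norm_nonneg _),
    hg.locallyLipschitz.comp lipschitzWith_one_norm.locallyLipschitz, fun T U hT hU t ht => ?_⟩
  simp only [sub_zero]
  exact norm_le_rpow_half (h T U hT hU t ht)

theorem isMittagLefflerStable_zero_of_two (hβ₀ : 0 < β) (hβ₁ : β ≤ 1) (hα₁ : 0 < α₁)
    (hα₂ : 0 < α₂) (hα₃ : 0 < α₃) (hV : IsQuadraticLyapunov V α₁ α₂) :
    IsMittagLefflerStable β α₃ 2 F V 0 := by
  refine isMittagLefflerStable_zero_of_sq_norm_le (lam := α₃ / α₂)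
    (g := fun r => α₂ / α₁ * r ^ 2) (by positivity) (by fun_prop) (by simp)
    (fun r _ => by positivity) fun T U hT hU t ht => ?_
  have hE : 0 ≤ mittagLeffler β (-(α₃ / α₂ * t ^ β)) :=
    mittagLeffler_neg_nonneg hβ₀ hβ₁ (mul_nonneg (by positivity) (Real.rpow_nonneg ht.1 _))
  have h := hU.le_mittagLeffler_of_two hβ₀ hβ₁ hα₃ hα₂ hV hT t ht
  calc ‖U t‖ ^ 2 ≤ V (U t) / α₁ := hV.sq_norm_le hα₁ _
    _ ≤ α₂ * ‖U 0‖ ^ 2 * mittagLeffler β (-(α₃ / α₂ * t ^ β)) / α₁ := by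
      gcongr
      exact h.trans (by gcongr; exact (hV.2 _).2)
    _ = _ := by ring

theorem isMittagLefflerStable_zero_of_one (hβ₀ : 0 < β) (hβ₁ : β ≤ 1) (hα₁ : 0 < α₁)
    (hα₂ : 0 < α₂) (hα₃ : 0 < α₃) (hV : IsQuadraticLyapunov V α₁ α₂) :
    IsMittagLefflerStable β α₃ 1 F V 0 := by
  rcases hβ₁.eq_or_lt with rfl | hlt
  · refine isMittagLefflerStable_zero_of_sq_norm_le (lam := α₃ / α₂)
      (g := fun r => α₂ / α₁ * r ^ 2 * Real.exp (α₃ / α₂ * (2 * α₂ / α₃ * r)))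
      (by positivity) (by fun_prop) (by simp)
      (fun r _ => by positivity) fun T U hT hU t ht => ?_
    have h := hU.le_exp_of_one hα₁ hα₂ hα₃ hV hT (lam := α₃ / α₂) (by positivity) t ht
    rw [mittagLeffler_one, Real.rpow_one]
    calc ‖U t‖ ^ 2 ≤ V (U t) / α₁ := hV.sq_norm_le hα₁ _
      _ ≤ α₂ * ‖U 0‖ ^ 2 * Real.exp (α₃ / α₂ * (2 * α₂ / α₃ * ‖U 0‖)) *
          Real.exp (-(α₃ / α₂ * t)) / α₁ := by
        gcongr
        exact h.trans (by gcongr; exact (hV.2 _).2)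
      _ = _ := by ring
  · obtain ⟨C, hC, hE⟩ := exists_mittagLeffler_neg_mul_le hβ₀ hlt
    refine isMittagLefflerStable_zero_of_sq_norm_le (lam := α₃ / α₂)
      (g := fun r => α₂ / α₁ * r ^ 2 * (C * (1 + Real.sqrt (α₂ / α₁) * r)))
      (by positivity) (by fun_prop) (by simp)
      (fun r _ => by positivity) fun T U hT hU t ht => ?_
    have h := hU.le_mittagLeffler_of_one hβ₀ hβ₁ hα₃ hα₁ hα₂ hV hT t ht
    set K := max 1 (Real.sqrt (V (U 0) / α₁)) with hK
    have hK1 : 1 ≤ K := le_max_left _ _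
    have hKpos : 0 < K := by linarith
    have hx : 0 ≤ α₃ / α₂ * t ^ β := mul_nonneg (by positivity) (Real.rpow_nonneg ht.1 _)
    have hE0 := mittagLeffler_neg_nonneg hβ₀ hβ₁ hx
    -- With κ = 1/K the slow rate α₃/(α₂K) is traded for α₃/α₂ at the price of the factor CK.
    have h1 := hE K⁻¹ (α₃ / α₂ * t ^ β) (by positivity) (inv_le_one_of_one_le₀ hK1) hx
    rw [div_inv_eq_mul, show K⁻¹ * (α₃ / α₂ * t ^ β) = α₃ / (α₂ * K) * t ^ β by field_simp] at h1
    -- An affine majorant of K in ‖U(0)‖, so that g is a polynomial.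
    have hKle : K ≤ 1 + Real.sqrt (α₂ / α₁) * ‖U 0‖ := by
      refine max_le (by linarith [mul_nonneg (Real.sqrt_nonneg (α₂ / α₁)) (norm_nonneg (U 0))]) ?_
      have : Real.sqrt (V (U 0) / α₁) ≤ Real.sqrt (α₂ / α₁) * ‖U 0‖ := by
        rw [← Real.sqrt_sq (norm_nonneg (U 0)), ← Real.sqrt_mul (by positivity)]
        refine Real.sqrt_le_sqrt ?_
        rw [div_mul_eq_mul_div]
        gcongr
        simpa using (hV.2 (U 0)).2
      linarith
    have h0 := hV.nonneg hα₁ (U 0)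
    calc ‖U t‖ ^ 2 ≤ V (U t) / α₁ := hV.sq_norm_le hα₁ _
      _ ≤ α₂ * ‖U 0‖ ^ 2 * (C * (1 + Real.sqrt (α₂ / α₁) * ‖U 0‖) *
          mittagLeffler β (-(α₃ / α₂ * t ^ β))) / α₁ := by
        gcongr
        refine h.trans ((mul_le_mul_of_nonneg_left h1 h0).trans ?_)
        gcongr
        exact (hV.2 _).2
      _ = _ := by ring

theorem IsProjectedEquilibrium.eq_zero {Ustar : Feature N d} (hα₃ : 0 < α₃)
    (hV : ContDiff ℝ 1 V) (h : IsProjectedEquilibrium β α₃ p F V Ustar) :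
    Ustar = 0 := by
  obtain ⟨-, hc⟩ := (h 1 one_pos).caputo_le hV
  -- Since (0,1) has positive measure, the almost-everywhere inequality holds at some time; there it
  -- reads 0 ≤ -α₃‖U*‖^p.
  have : (ae (volume.restrict (Ioo (0 : ℝ) 1))).NeBot := by
    rw [ae_neBot, Ne, Measure.restrict_eq_zero]
    simp
  obtain ⟨t, -, ht⟩ := hc.exists
  have h0 : caputo β (fun _ : ℝ => V Ustar) t = 0 := by simp [caputo]
  rw [h0] at ht
  by_contra hne
  have : 0 < ‖Ustar‖ := norm_pos_iff.2 hne
  have : 0 < α₃ * ‖Ustar‖ ^ p := by positivity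
  linarith

end Flow

theorem proposition2 (N d : ℕ) (β α₃ : ℝ) (hβ₀ : 0 < β) (hβ₁ : β ≤ 1) (hα₃ : 0 < α₃)
    (F : ℝ → Feature N d → Feature N d) :
    (∀ (δ : ℝ) (net : ICNN N d), 0 < δ →
      ∃ α₁ α₂ : ℝ, 0 < α₁ ∧ 0 < α₂ ∧ IsQuadraticLyapunov (net.lyapunov δ) α₁ α₂) ∧
    ∀ (V : Feature N d → ℝ) (α₁ α₂ : ℝ), 0 < α₁ → 0 < α₂ → IsQuadraticLyapunov V α₁ α₂ →
      -- equilibria and Mittag-Leffler stability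
      (∀ p : ℕ, p = 1 ∨ p = 2 →
        IsMittagLefflerStable β α₃ p F V 0 ∧
        ∀ Ustar : Feature N d, IsProjectedEquilibrium β α₃ p F V Ustar →
          Ustar = 0 ∧ IsMittagLefflerStable β α₃ p F V Ustar) ∧
      -- the explicit bounds for the quadratic constraint
      (∀ (T : ℝ) (U : ℝ → Feature N d), 0 < T → IsProjectedSolution β α₃ 2 F V T U →
        0 ≤ V (U 0) / α₁ ∧ (V (U 0) / α₁ = 0 ↔ U 0 = 0) ∧
        ∀ t ∈ Set.Icc (0 : ℝ) T,
          V (U t) ≤ V (U 0) * mittagLeffler β (-(α₃ / α₂ * t ^ β)) ∧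
          ‖U t‖ ≤ (V (U 0) / α₁ * mittagLeffler β (-(α₃ / α₂ * t ^ β))) ^ (1 / 2 : ℝ)) ∧
      -- the explicit bounds for the linear constraint
      (∀ (T : ℝ) (U : ℝ → Feature N d), 0 < T → IsProjectedSolution β α₃ 1 F V T U →
        ∀ t ∈ Set.Icc (0 : ℝ) T,
          V (U t) ≤ V (U 0) *
            mittagLeffler β (-(α₃ / (α₂ * max 1 (Real.sqrt (V (U 0) / α₁))) * t ^ β)) ∧
          ‖U t‖ ≤ (V (U 0) / α₁ *
            mittagLeffler β (-(α₃ / (α₂ * max 1 (Real.sqrt (V (U 0) / α₁))) * t ^ β)))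
              ^ (1 / 2 : ℝ)) := by
  refine ⟨fun δ net hδ => net.exists_isQuadraticLyapunov hδ,
    fun V α₁ α₂ hα₁ hα₂ hV => ⟨fun p hp => ?_, fun T U hT hU => ?_, fun T U hT hU t ht => ?_⟩⟩
  · have hstable : IsMittagLefflerStable β α₃ p F V 0 := by
      rcases hp with rfl | rfl
      · exact isMittagLefflerStable_zero_of_one hβ₀ hβ₁ hα₁ hα₂ hα₃ hV
      · exact isMittagLefflerStable_zero_of_two hβ₀ hβ₁ hα₁ hα₂ hα₃ hV
    refine ⟨hstable, fun Ustar hs => ?_⟩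
    obtain rfl : Ustar = 0 := hs.eq_zero hα₃ hV.1
    exact ⟨rfl, hstable⟩
  · refine ⟨div_nonneg (hV.nonneg hα₁ _) hα₁.le, ?_, fun t ht => ?_⟩
    · rw [div_eq_zero_iff, or_iff_left hα₁.ne', hV.eq_zero_iff hα₁]
    · have h := hU.le_mittagLeffler_of_two hβ₀ hβ₁ hα₃ hα₂ hV hT t ht
      refine ⟨h, norm_le_rpow_half ((hV.sq_norm_le hα₁ _).trans ?_)⟩
      rw [div_mul_eq_mul_div]
      gcongr
  · have h := hU.le_mittagLeffler_of_one hβ₀ hβ₁ hα₃ hα₁ hα₂ hV hT t ht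
    refine ⟨h, norm_le_rpow_half ((hV.sq_norm_le hα₁ _).trans ?_)⟩
    rw [div_mul_eq_mul_div]
    gcongr
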